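/- A rational language over a finite alphabet $A$ is taken to be given either by a finite nondeterministic automaton over $A$ or by a rational expression over $A$. First-order logic on words uses, besides equality and variables ranging over the positions of a word, the order $<$ on positions, the successor relation $S$, and a predicate $R_a$ ("position $x$ carries the letter $a$") for each $a\in A$. A language $L\subseteq A^*$ is first-order definable if there is a sentence $\varphi$ such that $L$ is the set of words $w$ with $w\models\varphi$. This is equivalent to definability by a sentence of $\mathsf{FO}(<)$, that is, one that does not use $S$. **Claim.** It is decidable whether a rational language is first-order definable: there is an algorithm which, given (the size of) a finite alphabet and an automaton over it, decides whether the language it accepts is first-order definable, and there is an algorithm which, given a finite alphabet and a rational expression over it, decides whether the language it denotes is first-order definable. More precisely, write $\mathcal A_{\min}(L)$ for the minimal complete deterministic automaton of $L$, with states the left quotients $u^{-1}L$, and $M(L)=A^*/{\cong_L}$ for the syntactic monoid of $L$, where $u\cong_L v$ if and only if for all $x,y\in A^*$: $xuy\in L\Leftrightarrow xvy\in L$. Then: 1. (a description of) $\mathcal A_{\min}(L)$ is computable from any automaton accepting $L$, and from any rational expression denoting $L$; 2. the multiplication table of $M(L)$ is computable from $\mathcal A_{\min}(L)$; 3. it is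 decidable from the multiplication table of a finite monoid $M$ whether $m^{|M|-1}=m^{|M|}$ for all $m\in M$; 4. if $L$ is rational then $M=M(L)$ is finite, and $L$ is first-order definable if and only if $m^{|M|-1}=m^{|M|}$ for all $m\in M$. -/

import Mathlib

/-! ### First-order logic on words -/

/-- The relation symbols of first-order logic on words over `A`: the order `<`, the successor
relation `S`, and a unary symbol `R_a` for each letter `a`. -/
inductive WordRel (A : Type) : ℕ → Type
  | lt : WordRel A 2
  | succ : WordRel A 2
  | letter (a : A) : WordRel A 1

/-- The relation symbols of `FO(<)`: the order and the letters, but not the successor. -/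
inductive WordOrderRel (A : Type) : ℕ → Type
  | lt : WordOrderRel A 2
  | letter (a : A) : WordOrderRel A 1

/-- The first-order vocabulary of words, without function or constant symbols. -/
def wordLanguage (A : Type) : FirstOrder.Language := ⟨fun _ => Empty, WordRel A⟩

/-- The vocabulary of `FO(<)`. -/
def wordOrderLanguage (A : Type) : FirstOrder.Language := ⟨fun _ => Empty, WordOrderRel A⟩

/-- A word as a structure: the domain is the set of positions `0, …, |w| - 1` (empty for the empty
word), `<` and `S` have their usual meaning, and `R_a` is the set of positions that carry `a`. -/
instance wordStructure {A : Type} (w : List A) : (wordLanguage A).Structure (Fin w.length) where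
  funMap f _ := nomatch f
  RelMap
    | .lt, x => x 0 < x 1
    | .succ, x => (x 1 : ℕ) = (x 0 : ℕ) + 1
    | .letter a, x => w.get (x 0) = a

instance wordOrderStructure {A : Type} (w : List A) :
    (wordOrderLanguage A).Structure (Fin w.length) where
  funMap f _ := nomatch f
  RelMap
    | .lt, x => x 0 < x 1
    | .letter a, x => w.get (x 0) = a

/-- `L` is the language defined by some sentence of first-order logic on words. -/
def FODefinable {A : Type} (L : Language A) : Prop :=
  ∃ φ : (wordLanguage A).Sentence, ∀ w : List A, w ∈ L ↔ φ.Realize (Fin w.length)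

/-- `L` is the language defined by some sentence of `FO(<)`. -/
def FOLtDefinable {A : Type} (L : Language A) : Prop :=
  ∃ φ : (wordOrderLanguage A).Sentence, ∀ w : List A, w ∈ L ↔ φ.Realize (Fin w.length)

/-! ### The syntactic monoid -/

/-- The syntactic congruence of `L`: `u ≅ v` iff `xuy ∈ L ↔ xvy ∈ L` for all words `x`, `y`. -/
def syntacticCon {A : Type} (L : Language A) : Con (FreeMonoid A) where
  r u v := ∀ x y : FreeMonoid A,
    (x * u * y).toList ∈ L ↔ (x * v * y).toList ∈ L
  iseqv := ⟨fun _ _ _ => Iff.rfl, fun h x y => (h x y).symm, fun h k x y => (h x y).trans (k x y)⟩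
  mul' {u v u' v'} h k x y := by
    have h1 := h x (u' * y)
    have h2 := k (x * v) y
    simp only [mul_assoc] at h1 h2 ⊢
    exact h1.trans h2

/-- The syntactic monoid `M(L)`, the quotient of the free monoid by the syntactic congruence. -/
abbrev SyntacticMonoid {A : Type} (L : Language A) : Type := (syntacticCon L).Quotient

/-! ### Finite descriptions of automata, rational expressions and finite monoids

The alphabet of size `n` is `Fin n`. -/

/-- A finite description `(k, T, I, F)` of a nondeterministic automaton: the number of states, the
list of transitions `(p, a, q)`, the list of initial states and the list of final states. -/
abbrev AutomatonData : Type := ℕ × List (ℕ × ℕ × ℕ) × List ℕ × List ℕ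

/-- The automaton with alphabet `Fin n` and set of states `Fin k` described by `(k, T, I, F)`.
Entries of `T`, `I`, `F` that do not name letters or states play no role. -/
def AutomatonData.toNFA (n : ℕ) (d : AutomatonData) : NFA (Fin n) (Fin d.1) where
  step p a := {q | ((p : ℕ), (a : ℕ), (q : ℕ)) ∈ d.2.1}
  start := {q | (q : ℕ) ∈ d.2.2.1}
  accept := {q | (q : ℕ) ∈ d.2.2.2}

/-- `d` describes an automaton over `Fin n` that is isomorphic to the minimal automaton of `L`,
whose states are the left quotients of `L`. -/
def IsMinimalAutomaton (n : ℕ) (d : AutomatonData) (L : Language (Fin n)) : Prop :=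
  ∃ e : Fin d.1 ≃ Set.range L.leftQuotient,
    (∀ p a q, q ∈ (d.toNFA n).step p a ↔ L.toDFA.step (e p) a = e q) ∧
    (∀ q, q ∈ (d.toNFA n).start ↔ e q = L.toDFA.start) ∧
    (∀ q, q ∈ (d.toNFA n).accept ↔ e q ∈ L.toDFA.accept)

/-- The rational expression `e` written as a string in postfix (reverse Polish) notation, with the
numbers `0, 1, 2, 3, 4` for the symbols `∅`, `ε`, union, product and star, and `a + 5` for the
letter `a`. -/
def RegularExpression.postfixString {n : ℕ} : RegularExpression (Fin n) → List ℕ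
  | .zero => [0]
  | .epsilon => [1]
  | .char a => [(a : ℕ) + 5]
  | .plus e f => e.postfixString ++ f.postfixString ++ [2]
  | .comp e f => e.postfixString ++ f.postfixString ++ [3]
  | .star e => e.postfixString ++ [4]

/-- One step of reading a postfix string, with a stack of expressions. -/
def RegularExpression.readToken {n : ℕ} (st : List (RegularExpression (Fin n))) (c : ℕ) :
    List (RegularExpression (Fin n)) :=
  match c, st with
  | 0, st => .zero :: st
  | 1, st => .epsilon :: st
  | 2, f :: e :: st => .plus e f :: st
  | 3, f :: e :: st => .comp e f :: st
  | 4, e :: st => .star e :: st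
  | a + 5, st => if h : a < n then .char ⟨a, h⟩ :: st else st
  | _, st => st

theorem RegularExpression.foldl_readToken {n : ℕ} (e : RegularExpression (Fin n))
    (st : List (RegularExpression (Fin n))) : e.postfixString.foldl readToken st = e :: st := by
  induction e generalizing st with
  | zero => rfl
  | epsilon => rfl
  | char a => simp [postfixString, readToken]
  | plus e f he hf => simp [postfixString, he, hf, readToken]
  | comp e f he hf => simp [postfixString, he, hf, readToken]
  | star e he => simp [postfixString, he, readToken]

/-- Postfix notation is unambiguous. -/
theorem RegularExpression.postfixString_injective {n : ℕ} :
    Function.Injective (postfixString (n := n)) := by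
  intro e f h
  have := foldl_readToken e []
  rw [h, foldl_readToken f []] at this
  simpa using this.symm

/-- `t` is the multiplication table of `M` for some enumeration of `M`: the entry in row `i` and
column `j` is the index of the product of the `i`-th and the `j`-th element. -/
def IsMultiplicationTable (t : List (List ℕ)) (M : Type) [Mul M] : Prop :=
  ∃ e : Fin t.length ≃ M, ∀ i, t.get i = List.ofFn fun j => (e.symm (e i * e j) : ℕ)

/-!
# Decidability of first-order definability for rational languages

The test rests on the theorem of Schützenberger and of McNaughton and Papert: a rational language is
first-order definable iff its syntactic monoid is aperiodic.

*From formulas to aperiodicity.* The successor relation is definable from the order, which reduces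
everything to `FO(<)` (`foDefinable_iff_foLtDefinable`). A position cuts a word into two words that
can be played on independently, so the back-and-forth equivalence of words has the recursive
definition `BackForth`, from which it is clear that it is a congruence; tuples of positions are
handled by marking letters. As `k` rounds do not distinguish `u ^ N` from `u ^ (N + 1)` when
`2 ^ k ≤ N + 1` (`backForth_wordPow`), a definable language cannot count
(`FOLtDefinable.exists_pow`).

*From aperiodicity to formulas.* In an aperiodic monoid `m = p m q` implies `p m = m = m q`. Hence
`m` is the only factor of `m` that lies in both `m M` and `M m`. If `m ≠ 1`, then each of these
three properties of the value of a word can be expressed by boolean combinations of iterated marked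
products `K a K'`, where `K` and `K'` are unrestricted or consist of the words whose value is
some proper factor of `m` (`wordValue_eq_iff`). Marked products preserve definability
(`FOLtDefinable.markedProduct`), because formulas can be relativized to one side of a position.
Induction gives `foLtDefinable_wordValue_eq`.

*Computability.* The minimal automaton and the syntactic monoid are both determined by membership of
finitely many words: if `L` has at most `Q` left quotients, then words of length at most
`lengthBound Q` represent all left quotients and all syntactic classes, and they also separate them.
So a primitive recursive membership test together with a bound for the number of left quotients is
enough (`isMinimalAutomaton_minimalAutomaton`, `isMultiplicationTable_syntacticTable`). Both are
easy to get for automata, and for rational expressions by evaluating the postfix notation in a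
suitable algebra (`ExprAlgebra`).
-/

/-! ### Variables and atomic formulas -/

namespace WordFO

variable {A : Type}

/-- The variable that a term of `FO(<)` consists of; there are no function symbols. -/
def orderVar {β : Type} : (wordOrderLanguage A).Term β → β
  | .var x => x
  | .func f _ => (show Empty from f).elim

/-- The variable that a term of first-order logic on words consists of. -/
def wordVar {β : Type} : (wordLanguage A).Term β → β
  | .var x => x
  | .func f _ => (show Empty from f).elim

theorem realize_orderVar {β : Type} {w : List A} (t : (wordOrderLanguage A).Term β)
    (v : β → Fin w.length) : t.realize v = v (orderVar t) := by
  cases t with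
  | var x => rfl
  | func f _ => exact (show Empty from f).elim

theorem realize_wordVar {β : Type} {w : List A} (t : (wordLanguage A).Term β)
    (v : β → Fin w.length) : t.realize v = v (wordVar t) := by
  cases t with
  | var x => rfl
  | func f _ => exact (show Empty from f).elim

/-- The atomic formula `x < y`. -/
def ltF {n : ℕ} (x y : Empty ⊕ Fin n) : (wordOrderLanguage A).BoundedFormula Empty n :=
  FirstOrder.Language.Relations.boundedFormula₂ (L := wordOrderLanguage A) WordOrderRel.lt
    (.var x) (.var y)

/-- The atomic formula `R_a x`. -/
def letterF {n : ℕ} (a : A) (x : Empty ⊕ Fin n) : (wordOrderLanguage A).BoundedFormula Empty n :=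
  FirstOrder.Language.Relations.boundedFormula₁ (L := wordOrderLanguage A)
    (WordOrderRel.letter a) (.var x)

/-- The atomic formula `x = y`. -/
def eqF {n : ℕ} (x y : Empty ⊕ Fin n) : (wordOrderLanguage A).BoundedFormula Empty n :=
  .equal (.var x) (.var y)

section Realize

variable {w : List A} {n : ℕ} {v : Empty → Fin w.length} {xs : Fin n → Fin w.length}

theorem realize_ltF {x y : Empty ⊕ Fin n} :
    (ltF x y : (wordOrderLanguage A).BoundedFormula Empty n).Realize v xs ↔
      Sum.elim v xs x < Sum.elim v xs y :=
  FirstOrder.Language.BoundedFormula.realize_rel₂.trans Iff.rfl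

theorem realize_letterF {a : A} {x : Empty ⊕ Fin n} :
    (letterF a x).Realize v xs ↔ w.get (Sum.elim v xs x) = a :=
  FirstOrder.Language.BoundedFormula.realize_rel₁.trans Iff.rfl

theorem realize_eqF {x y : Empty ⊕ Fin n} :
    (eqF x y : (wordOrderLanguage A).BoundedFormula Empty n).Realize v xs ↔
      Sum.elim v xs x = Sum.elim v xs y :=
  Iff.rfl

theorem realize_orderRel_lt {ts : Fin 2 → (wordOrderLanguage A).Term (Empty ⊕ Fin n)} :
    (FirstOrder.Language.BoundedFormula.rel (L := wordOrderLanguage A) WordOrderRel.lt ts).Realize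
      v xs ↔ Sum.elim v xs (orderVar (ts 0)) < Sum.elim v xs (orderVar (ts 1)) := by
  exact Iff.of_eq (congrArg₂ (· < ·) (realize_orderVar (ts 0) (Sum.elim v xs))
    (realize_orderVar (ts 1) (Sum.elim v xs)))

theorem realize_orderRel_letter {a : A}
    {ts : Fin 1 → (wordOrderLanguage A).Term (Empty ⊕ Fin n)} :
    (FirstOrder.Language.BoundedFormula.rel (L := wordOrderLanguage A)
      (WordOrderRel.letter a) ts).Realize v xs ↔
      w.get (Sum.elim v xs (orderVar (ts 0))) = a := by
  exact Iff.of_eq (congrArg (w.get · = a) (realize_orderVar (ts 0) (Sum.elim v xs)))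

theorem realize_orderEqual {s t : (wordOrderLanguage A).Term (Empty ⊕ Fin n)} :
    (FirstOrder.Language.BoundedFormula.equal s t).Realize v xs ↔
      Sum.elim v xs (orderVar s) = Sum.elim v xs (orderVar t) := by
  exact Iff.of_eq (congrArg₂ (· = ·) (realize_orderVar s (Sum.elim v xs))
    (realize_orderVar t (Sum.elim v xs)))

end Realize

/-! ### Elimination of the successor relation -/

/-- `y` is the least position above `x`. -/
def succF {n : ℕ} (x y : Empty ⊕ Fin n) : (wordOrderLanguage A).BoundedFormula Empty n :=
  ltF x y ⊓ (FirstOrder.Language.BoundedFormula.ex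
    (ltF (x.map id Fin.castSucc) (.inr (Fin.last n)) ⊓
      ltF (.inr (Fin.last n)) (y.map id Fin.castSucc))).not

theorem elim_snoc_castSucc {M : Type} {n : ℕ} (v : Empty → M) (xs : Fin n → M) (p : M)
    (x : Empty ⊕ Fin n) :
    Sum.elim v (Fin.snoc xs p : Fin (n + 1) → M) (x.map id Fin.castSucc) = Sum.elim v xs x := by
  rcases x with x | x
  · exact x.elim
  · simp

theorem realize_succF {w : List A} {n : ℕ} {v : Empty → Fin w.length}
    {xs : Fin n → Fin w.length} {x y : Empty ⊕ Fin n} :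
    (succF x y : (wordOrderLanguage A).BoundedFormula Empty n).Realize v xs ↔
      ((Sum.elim v xs y : Fin w.length) : ℕ) = ((Sum.elim v xs x : Fin w.length) : ℕ) + 1 := by
  simp only [succF, FirstOrder.Language.BoundedFormula.realize_inf,
    FirstOrder.Language.BoundedFormula.realize_not, FirstOrder.Language.BoundedFormula.realize_ex,
    realize_ltF, elim_snoc_castSucc]
  simp only [Sum.elim_inr, Fin.snoc_last, not_exists, Fin.lt_def]
  generalize Sum.elim v xs x = p
  generalize Sum.elim v xs y = q
  constructor
  · rintro ⟨h, h'⟩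
    have := h' ⟨p + 1, by omega⟩
    simp only at this
    omega
  · rintro h
    exact ⟨by omega, fun z => by omega⟩

/-- The translation of an atomic formula into `FO(<)`. -/
def toOrderRel {n : ℕ} : ∀ {l : ℕ}, WordRel A l →
    (Fin l → (wordLanguage A).Term (Empty ⊕ Fin n)) →
    (wordOrderLanguage A).BoundedFormula Empty n
  | _, .lt, ts => ltF (wordVar (ts 0)) (wordVar (ts 1))
  | _, .succ, ts => succF (wordVar (ts 0)) (wordVar (ts 1))
  | _, .letter a, ts => letterF a (wordVar (ts 0))

/-- The translation of first-order logic on words into `FO(<)`. -/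
def toOrder : ∀ {n : ℕ}, (wordLanguage A).BoundedFormula Empty n →
    (wordOrderLanguage A).BoundedFormula Empty n
  | _, .falsum => .falsum
  | _, .equal s t => eqF (wordVar s) (wordVar t)
  | _, .rel R ts => toOrderRel R ts
  | _, .imp φ ψ => .imp (toOrder φ) (toOrder ψ)
  | _, .all φ => .all (toOrder φ)

theorem realize_toOrder {w : List A} {n : ℕ} (φ : (wordLanguage A).BoundedFormula Empty n)
    (v : Empty → Fin w.length) (xs : Fin n → Fin w.length) :
    (toOrder φ).Realize v xs ↔ φ.Realize v xs := by
  induction φ with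
  | falsum => exact Iff.rfl
  | equal s t =>
    exact (Iff.of_eq (congrArg₂ (· = ·) (realize_wordVar s (Sum.elim v xs))
      (realize_wordVar t (Sum.elim v xs)))).symm
  | rel R ts =>
    cases R with
    | lt =>
      exact realize_ltF.trans (Iff.of_eq (congrArg₂ (· < ·)
        (realize_wordVar (ts 0) (Sum.elim v xs)) (realize_wordVar (ts 1) (Sum.elim v xs)))).symm
    | succ =>
      exact realize_succF.trans (Iff.of_eq (congrArg₂ (fun p q : Fin w.length => (q : ℕ) = p + 1)
        (realize_wordVar (ts 0) (Sum.elim v xs)) (realize_wordVar (ts 1) (Sum.elim v xs)))).symm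
    | letter a =>
      exact realize_letterF.trans (Iff.of_eq (congrArg (w.get · = a)
        (realize_wordVar (ts 0) (Sum.elim v xs)))).symm
  | imp φ ψ hφ hψ => exact imp_congr (hφ xs) (hψ xs)
  | all φ h => exact forall_congr' fun p => h (Fin.snoc xs p)

/-- The inclusion of the vocabulary of `FO(<)` into that of first-order logic on words. -/
def orderInclusion (A : Type) : wordOrderLanguage A →ᴸ wordLanguage A where
  onFunction _ f := f
  onRelation
    | _, .lt => WordRel.lt
    | _, .letter a => WordRel.letter a

instance isExpansionOn_orderInclusion (w : List A) :
    (orderInclusion A).IsExpansionOn (Fin w.length) where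
  map_onFunction f := (show Empty from f).elim
  map_onRelation R _ := by cases R <;> rfl

theorem foDefinable_iff_foLtDefinable (L : Language A) : FODefinable L ↔ FOLtDefinable L := by
  constructor
  · rintro ⟨φ, hφ⟩
    exact ⟨toOrder φ, fun w => (hφ w).trans (realize_toOrder φ _ _).symm⟩
  · rintro ⟨φ, hφ⟩
    exact ⟨(orderInclusion A).onSentence φ, fun w => (hφ w).trans
      ((orderInclusion A).realize_onSentence (Fin w.length) φ).symm⟩

/-! ### Closure properties of the languages definable in `FO(<)` -/

theorem _root_.FOLtDefinable.congr {L K : Language A} (h : FOLtDefinable L)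
    (e : ∀ w, w ∈ K ↔ w ∈ L) : FOLtDefinable K := by
  obtain ⟨φ, hφ⟩ := h
  exact ⟨φ, fun w => (e w).trans (hφ w)⟩

theorem _root_.FOLtDefinable.compl {L : Language A} (h : FOLtDefinable L) :
    FOLtDefinable (A := A) {w | w ∉ L} := by
  obtain ⟨φ, hφ⟩ := h
  exact ⟨φ.not, fun w => (not_congr (hφ w)).trans FirstOrder.Language.Formula.realize_not.symm⟩

theorem _root_.FOLtDefinable.inter {L K : Language A} (h : FOLtDefinable L) (k : FOLtDefinable K) :
    FOLtDefinable (A := A) {w | w ∈ L ∧ w ∈ K} := by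
  obtain ⟨φ, hφ⟩ := h
  obtain ⟨ψ, hψ⟩ := k
  exact ⟨φ ⊓ ψ, fun w => (and_congr (hφ w) (hψ w)).trans
    FirstOrder.Language.Formula.realize_inf.symm⟩

theorem _root_.FOLtDefinable.univ : FOLtDefinable (A := A) {_w | True} :=
  ⟨⊤, fun _ => iff_of_true trivial (FirstOrder.Language.Formula.realize_top.2 trivial)⟩

theorem _root_.FOLtDefinable.exists {ι : Type} [Finite ι] {L : ι → Language A}
    (h : ∀ i, FOLtDefinable (L i)) : FOLtDefinable (A := A) {w | ∃ i, w ∈ L i} := by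
  choose φ hφ using h
  exact ⟨FirstOrder.Language.BoundedFormula.iSup φ, fun w =>
    (exists_congr fun i => hφ i w).trans FirstOrder.Language.BoundedFormula.realize_iSup.symm⟩

theorem _root_.FOLtDefinable.and_const {L : Language A} (p : Prop) (h : p → FOLtDefinable L) :
    FOLtDefinable (A := A) {w | p ∧ w ∈ L} := by
  by_cases hp : p
  · obtain ⟨φ, hφ⟩ := h hp
    exact ⟨φ, fun w => Iff.trans ⟨fun h => h.2, fun h => ⟨hp, h⟩⟩ (hφ w)⟩
  · exact ⟨⊥, fun w => iff_of_false (fun h => hp h.1) FirstOrder.Language.Formula.realize_bot.1⟩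

/-! ### Relativization to one side of a position -/

/-- The bounded variable `i` becomes `i + 1`, which makes room for a new variable `0`. -/
def shiftVar {n : ℕ} (x : Empty ⊕ Fin n) : Empty ⊕ Fin (n + 1) := x.map id Fin.succ

/-- The relativization of a formula to the positions below (if `below` holds) or above the position
denoted by the new variable `0`. -/
def relativize (below : Bool) : ∀ {n : ℕ}, (wordOrderLanguage A).BoundedFormula Empty n →
    (wordOrderLanguage A).BoundedFormula Empty (n + 1)
  | _, .falsum => .falsum
  | _, .equal s t => eqF (shiftVar (orderVar s)) (shiftVar (orderVar t))
  | _, .rel WordOrderRel.lt ts => ltF (shiftVar (orderVar (ts 0))) (shiftVar (orderVar (ts 1)))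
  | _, .rel (WordOrderRel.letter a) ts => letterF a (shiftVar (orderVar (ts 0)))
  | _, .imp φ ψ => .imp (relativize below φ) (relativize below ψ)
  | _, .all φ => .all (.imp
      (if below then ltF (.inr (Fin.last _)) (.inr 0) else ltF (.inr 0) (.inr (Fin.last _)))
      (relativize below φ))

theorem elim_cons_shiftVar {M N : Type} {n : ℕ} (v : Empty → M) (v' : Empty → N) (p : M)
    (f : N → M) (xs : Fin n → N) (x : Empty ⊕ Fin n) :
    Sum.elim v (Fin.cons p (f ∘ xs) : Fin (n + 1) → M) (shiftVar x) = f (Sum.elim v' xs x) := by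
  rcases x with x | x
  · exact x.elim
  · simp [shiftVar]

/-- A relativized formula holds in `w` iff the original formula holds in the factor `u` of `w`
that consists of the positions on the chosen side of `p`. -/
theorem realize_relativize {below : Bool} {w u : List A} (p : Fin w.length)
    (f : Fin u.length → Fin w.length) (hf : StrictMono f) (hget : ∀ i, w.get (f i) = u.get i)
    (hrange : ∀ q, (∃ i, f i = q) ↔ if below then q < p else p < q) {n : ℕ}
    (φ : (wordOrderLanguage A).BoundedFormula Empty n) (v : Empty → Fin w.length)
    (v' : Empty → Fin u.length) (xs : Fin n → Fin u.length) :
    (relativize below φ).Realize v (Fin.cons p (f ∘ xs) : Fin (n + 1) → Fin w.length) ↔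
      φ.Realize v' xs := by
  induction φ with
  | falsum => exact Iff.rfl
  | equal s t =>
    rw [relativize, realize_eqF, elim_cons_shiftVar v v', elim_cons_shiftVar v v',
      realize_orderEqual, hf.injective.eq_iff]
  | rel R ts =>
    cases R with
    | lt =>
      rw [relativize, realize_ltF, elim_cons_shiftVar v v', elim_cons_shiftVar v v',
        realize_orderRel_lt, hf.lt_iff_lt]
    | letter a =>
      rw [relativize, realize_letterF, elim_cons_shiftVar v v', hget, realize_orderRel_letter]
  | imp φ ψ hφ hψ => exact imp_congr (hφ xs) (hψ xs)
  | @all n φ h =>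
    have key : ∀ q, (if below then (ltF (.inr (Fin.last _)) (.inr 0) :
          (wordOrderLanguage A).BoundedFormula Empty (n + 1 + 1))
        else ltF (.inr 0) (.inr (Fin.last _))).Realize v
          (Fin.snoc (Fin.cons p (f ∘ xs) : Fin (n + 1) → Fin w.length) q) ↔ ∃ i, f i = q := by
      intro q
      rw [hrange, ← Fin.cons_snoc_eq_snoc_cons]
      cases below
      · simp [realize_ltF, ← Fin.succ_last]
      · simp [realize_ltF, ← Fin.succ_last]
    have key' : ∀ i, (Fin.snoc (Fin.cons p (f ∘ xs) : Fin (n + 1) → Fin w.length) (f i) :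
        Fin (n + 2) → Fin w.length) = Fin.cons p (f ∘ (Fin.snoc xs i : Fin (n + 1) → _)) := by
      intro i
      rw [← Fin.cons_snoc_eq_snoc_cons, Fin.comp_snoc]
    rw [relativize, FirstOrder.Language.BoundedFormula.realize_all,
      FirstOrder.Language.BoundedFormula.realize_all]
    simp only [FirstOrder.Language.BoundedFormula.realize_imp]
    constructor
    · intro hq i
      rw [← h, ← key']
      exact hq _ ((key _).2 ⟨i, rfl⟩)
    · intro hi q hq
      obtain ⟨i, rfl⟩ := (key q).1 hq
      rw [key', h]
      exact hi i

/-- The languages definable in `FO(<)` are closed under the marked product `K a K'`. -/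
theorem _root_.FOLtDefinable.markedProduct {K K' : Language A} (h : FOLtDefinable K)
    (h' : FOLtDefinable K') (a : A) :
    FOLtDefinable (A := A) {w | ∃ u ∈ K, ∃ v ∈ K', w = u ++ a :: v} := by
  obtain ⟨φ, hφ⟩ := h
  obtain ⟨ψ, hψ⟩ := h'
  refine ⟨FirstOrder.Language.BoundedFormula.ex
    (letterF a (.inr 0) ⊓ (relativize true φ ⊓ relativize false ψ)), fun w => ?_⟩
  have main : ∀ (u v : List A) (p : Fin (u ++ a :: v).length) (_ : (p : ℕ) = u.length)
      (d : Empty → Fin (u ++ a :: v).length) (xs : Fin 0 → Fin (u ++ a :: v).length),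
      (letterF a (.inr 0) ⊓ (relativize true φ ⊓ relativize false ψ) :
        (wordOrderLanguage A).BoundedFormula Empty 1).Realize d (Fin.snoc xs p) ↔
      u ∈ K ∧ v ∈ K' := by
    intro u v p hp d xs
    have hsnoc : ∀ {u' : List A} (f : Fin u'.length → Fin (u ++ a :: v).length)
        (ys : Fin 0 → Fin u'.length), (Fin.snoc xs p : Fin 1 → Fin (u ++ a :: v).length) =
          (Fin.cons p (f ∘ ys) : Fin 1 → Fin (u ++ a :: v).length) := by
      intro u' f ys
      funext i
      rw [show i = Fin.last 0 from Subsingleton.elim (α := Fin 1) _ _, Fin.snoc_last]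
      rfl
    rw [FirstOrder.Language.BoundedFormula.realize_inf,
      FirstOrder.Language.BoundedFormula.realize_inf, realize_letterF]
    have h1 : (u ++ a :: v).get (Sum.elim d (Fin.snoc xs p) (.inr 0)) = a := by
      have : (Fin.snoc xs p : Fin 1 → Fin (u ++ a :: v).length) 0 = p := by
        rw [show (0 : Fin 1) = Fin.last 0 from rfl, Fin.snoc_last]
      rw [Sum.elim_inr, this]
      simp [hp]
    have h2 : (relativize true φ).Realize d (Fin.snoc xs p : Fin 1 → _) ↔ u ∈ K := by
      rw [hφ u, hsnoc (u' := u) (fun i => ⟨i, by simp; omega⟩) default]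
      refine realize_relativize p (fun i : Fin u.length => ⟨i, by simp; omega⟩)
        (fun i j hij => hij) (fun i => ?_) (fun q => ?_) φ _ _ _
      · simp
      · simp only [if_true, Fin.lt_def, hp]
        exact ⟨fun ⟨i, hi⟩ => by rw [← hi]; exact i.2, fun hq => ⟨⟨q, hq⟩, rfl⟩⟩
    have h3 : (relativize false ψ).Realize d (Fin.snoc xs p : Fin 1 → _) ↔ v ∈ K' := by
      rw [hψ v, hsnoc (u' := v) (fun i => ⟨u.length + 1 + i, by simp; omega⟩) default]
      refine realize_relativize p (fun i : Fin v.length => ⟨u.length + 1 + i, by simp; omega⟩)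
        (fun i j hij => ?_) (fun i => ?_) (fun q => ?_) ψ _ _ _
      · simp only [Fin.lt_def] at hij ⊢
        omega
      · simp [List.getElem_append_right, add_assoc, Nat.add_comm 1]
      · have hq2 := q.2
        simp only [List.length_append, List.length_cons] at hq2
        simp only [Bool.false_eq_true, if_false, Fin.lt_def, hp]
        constructor
        · rintro ⟨i, hi⟩
          rw [← hi]
          simp only
          omega
        · intro hq
          exact ⟨⟨q - (u.length + 1), by omega⟩, Fin.ext (by simp only; omega)⟩
    rw [h2, h3]
    simp only [h1, true_and]
  change (∃ u ∈ K, ∃ v ∈ K', w = u ++ a :: v) ↔ _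
  rw [FirstOrder.Language.Sentence.Realize, FirstOrder.Language.Formula.Realize,
    FirstOrder.Language.BoundedFormula.realize_ex]
  constructor
  · rintro ⟨u, hu, v, hv, rfl⟩
    exact ⟨⟨u.length, by simp⟩, (main u v _ rfl _ _).2 ⟨hu, hv⟩⟩
  · rintro ⟨p, hp⟩
    obtain ⟨u, b, v, hw, hlen⟩ : ∃ u b v, w = u ++ b :: v ∧ (p : ℕ) = u.length :=
      ⟨w.take p, w.get p, w.drop (p + 1), by simp, by simp⟩
    have hb : b = a := by
      have := (FirstOrder.Language.BoundedFormula.realize_inf.1 hp).1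
      rw [realize_letterF, Sum.elim_inr, show (0 : Fin 1) = Fin.last 0 from rfl,
        Fin.snoc_last] at this
      subst hw
      simpa [hlen] using this
    subst hw hb
    obtain ⟨hu, hv⟩ := (main u v p hlen _ _).1 hp
    exact ⟨u, hu, v, hv, rfl⟩

end WordFO

/-! ### Definable languages do not count -/

namespace WordFO

variable {A X : Type}

/-- The back-and-forth equivalence of words for `k` rounds: every factorization of one word at a
position is matched by a factorization of the other at a position with the same letter, so that the
two left parts and the two right parts are equivalent for `k - 1` rounds. -/
def BackForth : ℕ → List X → List X → Prop
  | 0, _, _ => True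
  | k + 1, w, w' =>
    (∀ u x v, w = u ++ x :: v →
      ∃ u' v', w' = u' ++ x :: v' ∧ BackForth k u u' ∧ BackForth k v v') ∧
    (∀ u' x v', w' = u' ++ x :: v' →
      ∃ u v, w = u ++ x :: v ∧ BackForth k u u' ∧ BackForth k v v')

theorem BackForth.refl (k : ℕ) (w : List X) : BackForth k w w := by
  induction k generalizing w with
  | zero => trivial
  | succ k ih =>
    exact ⟨fun u x v h => ⟨u, v, h, ih u, ih v⟩, fun u x v h => ⟨u, v, h, ih u, ih v⟩⟩

theorem BackForth.symm {k : ℕ} {w w' : List X} (h : BackForth k w w') : BackForth k w' w := by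
  induction k generalizing w w' with
  | zero => trivial
  | succ k ih =>
    constructor
    · intro u x v e
      obtain ⟨u', v', e', hu, hv⟩ := h.2 u x v e
      exact ⟨u', v', e', ih hu, ih hv⟩
    · intro u x v e
      obtain ⟨u', v', e', hu, hv⟩ := h.1 u x v e
      exact ⟨u', v', e', ih hu, ih hv⟩

theorem BackForth.of_succ {k : ℕ} {w w' : List X} (h : BackForth (k + 1) w w') :
    BackForth k w w' := by
  induction k generalizing w w' with
  | zero => trivial
  | succ k ih =>
    constructor
    · intro u x v e
      obtain ⟨u', v', e', hu, hv⟩ := h.1 u x v e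
      exact ⟨u', v', e', ih hu, ih hv⟩
    · intro u x v e
      obtain ⟨u', v', e', hu, hv⟩ := h.2 u x v e
      exact ⟨u', v', e', ih hu, ih hv⟩

theorem BackForth.mono {k l : ℕ} (hkl : k ≤ l) {w w' : List X} (h : BackForth l w w') :
    BackForth k w w' := by
  induction hkl with
  | refl => exact h
  | step _ ih => exact ih h.of_succ

/-- A factorization of a concatenation at a position is induced by one of the two words. -/
theorem append_eq_append_cons {w z u v : List X} {x : X} (h : w ++ z = u ++ x :: v) :
    (∃ t, w = u ++ x :: t ∧ v = t ++ z) ∨ ∃ t, z = t ++ x :: v ∧ u = w ++ t := by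
  rcases List.append_eq_append_iff.1 h with ⟨t, ht, ht'⟩ | ⟨t, ht, ht'⟩
  · exact Or.inr ⟨t, ht', ht⟩
  · cases t with
    | nil => exact Or.inr ⟨[], by simpa using ht'.symm, by simpa using ht.symm⟩
    | cons y t =>
      obtain ⟨rfl, rfl⟩ : x = y ∧ v = t ++ z := by simpa using ht'
      exact Or.inl ⟨t, ht, rfl⟩

theorem BackForth.append {k : ℕ} {w w' z z' : List X} (h : BackForth k w w')
    (h' : BackForth k z z') : BackForth k (w ++ z) (w' ++ z') := by
  have half : ∀ k, (∀ w w' z z' : List X, BackForth k w w' → BackForth k z z' →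
      BackForth k (w ++ z) (w' ++ z')) → ∀ {w w' z z' : List X},
      BackForth (k + 1) w w' → BackForth (k + 1) z z' → ∀ u x v, w ++ z = u ++ x :: v →
      ∃ u' v', w' ++ z' = u' ++ x :: v' ∧ BackForth k u u' ∧ BackForth k v v' := by
    intro k ih w w' z z' h h' u x v e
    rcases append_eq_append_cons e with ⟨t, rfl, rfl⟩ | ⟨t, rfl, rfl⟩
    · obtain ⟨u', t', rfl, hu, ht⟩ := h.1 u x t rfl
      exact ⟨u', t' ++ z', by simp, hu, ih _ _ _ _ ht h'.of_succ⟩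
    · obtain ⟨t', v', rfl, ht, hv⟩ := h'.1 t x v rfl
      exact ⟨w' ++ t', v', by simp, ih _ _ _ _ h.of_succ ht, hv⟩
  induction k generalizing w w' z z' with
  | zero => trivial
  | succ k ih =>
    refine ⟨half k (fun _ _ _ _ => ih) h h', fun u x v e => ?_⟩
    obtain ⟨u', v', e', hu, hv⟩ := half k (fun _ _ _ _ => ih) h.symm h'.symm u x v e
    exact ⟨u', v', e', hu.symm, hv.symm⟩

/-- The word `u ⋯ u` with `N` factors. -/
def wordPow (u : List X) (N : ℕ) : List X := (List.replicate N u).flatten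

theorem wordPow_add (u : List X) (i j : ℕ) : wordPow u (i + j) = wordPow u i ++ wordPow u j := by
  rw [wordPow, List.replicate_add, List.flatten_append, wordPow, wordPow]

theorem wordPow_one (u : List X) : wordPow u 1 = u := by simp [wordPow]

theorem wordPow_split {u s t : List X} {x : X} (hu : u = s ++ x :: t) (i j : ℕ) :
    wordPow u (i + 1 + j) = (wordPow u i ++ s) ++ x :: (t ++ wordPow u j) := by
  rw [wordPow_add, wordPow_add, wordPow_one]
  generalize wordPow u i = y
  generalize wordPow u j = z
  simp [hu]

/-- A position of a power lies in one of its factors. -/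
theorem wordPow_eq_append_cons {u p q : List X} {x : X} {N : ℕ} (h : wordPow u N = p ++ x :: q) :
    ∃ i j s t, N = i + 1 + j ∧ u = s ++ x :: t ∧ p = wordPow u i ++ s ∧ q = t ++ wordPow u j := by
  induction N generalizing p with
  | zero => simp [wordPow] at h
  | succ N ih =>
    rw [Nat.add_comm, wordPow_add, wordPow_one] at h
    rcases append_eq_append_cons h with ⟨t, hu, hq⟩ | ⟨t, ht, hp⟩
    · exact ⟨0, N, p, t, by omega, hu, by simp [wordPow], hq⟩
    · obtain ⟨i, j, s, r, rfl, hu, rfl, rfl⟩ := ih ht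
      exact ⟨1 + i, j, s, r, by omega, hu, by rw [hp, wordPow_add, wordPow_one]; simp, rfl⟩

/-- `k` rounds do not distinguish a large power from the next one: the chosen position leaves a
power with half as many factors on one of its sides, where the extra factor can be hidden. -/
theorem backForth_wordPow (u : List X) {k N : ℕ} (hN : 2 ^ k ≤ N + 1) :
    BackForth k (wordPow u N) (wordPow u (N + 1)) := by
  induction k generalizing N with
  | zero => trivial
  | succ k ih =>
    rw [pow_succ] at hN
    constructor
    · intro p x q h
      obtain ⟨i, j, s, t, rfl, hu, rfl, rfl⟩ := wordPow_eq_append_cons h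
      by_cases hi : 2 ^ k ≤ i + 1
      · refine ⟨wordPow u (i + 1) ++ s, t ++ wordPow u j, ?_, (ih hi).append (.refl _ _), .refl _ _⟩
        rw [show i + 1 + j + 1 = (i + 1) + 1 + j by omega, wordPow_split hu]
      · refine ⟨wordPow u i ++ s, t ++ wordPow u (j + 1), ?_, .refl _ _,
          .append (.refl _ _) (ih (by omega))⟩
        rw [show i + 1 + j + 1 = i + 1 + (j + 1) by omega, wordPow_split hu]
    · intro p x q h
      obtain ⟨i, j, s, t, hN', hu, rfl, rfl⟩ := wordPow_eq_append_cons h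
      by_cases hi : 2 ^ k ≤ i
      · obtain ⟨i, rfl⟩ : ∃ i', i = i' + 1 := ⟨i - 1, by have := Nat.two_pow_pos k; omega⟩
        refine ⟨wordPow u i ++ s, t ++ wordPow u j, ?_, (ih hi).append (.refl _ _), .refl _ _⟩
        rw [show N = i + 1 + j by omega, wordPow_split hu]
      · obtain ⟨j, rfl⟩ : ∃ j', j = j' + 1 := ⟨j - 1, by omega⟩
        refine ⟨wordPow u i ++ s, t ++ wordPow u j, ?_, .refl _ _,
          .append (.refl _ _) (ih (by omega))⟩
        rw [show N = i + 1 + j by omega, wordPow_split hu]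

/-- The indices of the variables that denote the position `p`. -/
def marks {M : Type} {n : ℕ} (xs : Fin n → M) (p : M) : Set ℕ :=
  {m | ∃ i : Fin n, (i : ℕ) = m ∧ xs i = p}

/-- The word `w` with each position marked by the indices of the variables that denote it. -/
def markedWord (w : List A) {n : ℕ} (xs : Fin n → Fin w.length) : List (A × Set ℕ) :=
  List.ofFn fun p => (w.get p, marks xs p)

theorem length_markedWord {w : List A} {n : ℕ} (xs : Fin n → Fin w.length) :
    (markedWord w xs).length = w.length := by simp [markedWord]

theorem get_markedWord {w : List A} {n : ℕ} (xs : Fin n → Fin w.length) (p : Fin w.length)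
    (h : (p : ℕ) < (markedWord w xs).length) :
    (markedWord w xs)[(p : ℕ)] = (w.get p, marks xs p) := by
  simp [markedWord]

/-- Splitting a marked word at a position. -/
theorem markedWord_split {w : List A} {n : ℕ} (xs : Fin n → Fin w.length) (p : Fin w.length) :
    ∃ u v, u.length = (p : ℕ) ∧
      markedWord w xs = u ++ (w.get p, marks xs p) :: v := by
  have hp : (p : ℕ) < (markedWord w xs).length := by rw [length_markedWord]; exact p.2
  refine ⟨(markedWord w xs).take p, (markedWord w xs).drop (p + 1),
    by rw [List.length_take]; omega, ?_⟩
  rw [← get_markedWord xs p hp, List.cons_getElem_drop_succ, List.take_append_drop]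

/-- A splitting of a marked word comes from a position. -/
theorem exists_position {w : List A} {n : ℕ} {xs : Fin n → Fin w.length}
    {u v : List (A × Set ℕ)} {x : A × Set ℕ} (h : markedWord w xs = u ++ x :: v) :
    ∃ p : Fin w.length, u.length = (p : ℕ) ∧ x = (w.get p, marks xs p) := by
  have hlen := length_markedWord xs
  have hp : u.length < w.length := by rw [← hlen, h]; simp
  refine ⟨⟨u.length, hp⟩, rfl, ?_⟩
  rw [← get_markedWord xs ⟨u.length, hp⟩ (by rw [hlen]; exact hp)]
  simp [h]

/-- Extending the tuple by a position changes only the mark of that position. -/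
theorem markedWord_snoc {w : List A} {n : ℕ} {xs : Fin n → Fin w.length} {p : Fin w.length}
    {u v : List (A × Set ℕ)} {x : A × Set ℕ} (h : markedWord w xs = u ++ x :: v)
    (hu : u.length = (p : ℕ)) :
    markedWord w (Fin.snoc xs p : Fin (n + 1) → Fin w.length) =
      u ++ (x.1, insert n x.2) :: v := by
  have hlen := length_markedWord xs
  obtain ⟨p', hp', hx⟩ := exists_position h
  obtain rfl : p' = p := Fin.ext (hp'.symm.trans hu)
  apply List.ext_getElem
  · rw [length_markedWord, ← hlen, h]
    simp
  · intro q hq hq'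
    rw [length_markedWord] at hq
    have hold := get_markedWord xs ⟨q, hq⟩ (by rw [hlen]; exact hq)
    rw [get_markedWord (Fin.snoc xs p' : Fin (n + 1) → Fin w.length) ⟨q, hq⟩ (by
      rw [length_markedWord]; exact hq)]
    have hset : marks (Fin.snoc xs p' : Fin (n + 1) → Fin w.length) ⟨q, hq⟩ =
        {m | m ∈ marks xs ⟨q, hq⟩ ∨ (m = n ∧ p' = ⟨q, hq⟩)} := by
      ext m
      simp [marks, Fin.exists_fin_succ', eq_comm]
    rw [hset]
    simp only [h] at hold
    rcases lt_trichotomy q u.length with hlt | heq | hgt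
    · have hne : p' ≠ ⟨q, hq⟩ := by rintro rfl; simp at hp'; omega
      rw [List.getElem_append_left hlt] at hold ⊢
      simp [hold, hne]
    · subst heq
      obtain rfl : p' = ⟨u.length, hq⟩ := Fin.ext hp'.symm
      simp [hx, Set.ext_iff, or_comm]
    · have hne : p' ≠ ⟨q, hq⟩ := by rintro rfl; simp at hp'; omega
      obtain ⟨r, rfl⟩ : ∃ r, q = u.length + 1 + r := ⟨q - (u.length + 1), by omega⟩
      rw [List.getElem_append_right (by omega)] at hold ⊢
      simp only [show u.length + 1 + r - u.length = r + 1 by omega,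
        List.getElem_cons_succ] at hold ⊢
      simp [hold, hne]

/-- The number of rounds that suffices for a formula: its quantifier depth, plus two for the atomic
formulas. -/
def rounds : ∀ {n : ℕ}, (wordOrderLanguage A).BoundedFormula Empty n → ℕ
  | _, .falsum => 0
  | _, .equal _ _ => 2
  | _, .rel _ _ => 2
  | _, .imp φ ψ => max (rounds φ) (rounds ψ)
  | _, .all φ => rounds φ + 1

/-- The index of a variable. -/
def varIndex {n : ℕ} (x : Empty ⊕ Fin n) : Fin n := x.elim (fun e => e.elim) id

theorem elim_eq_varIndex {M : Type} {n : ℕ} (v : Empty → M) (xs : Fin n → M)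
    (x : Empty ⊕ Fin n) : Sum.elim v xs x = xs (varIndex x) := by
  rcases x with x | x
  · exact x.elim
  · rfl

theorem BackForth.eq_of_eq {w w' : List A} {n : ℕ} {xs : Fin n → Fin w.length}
    {xs' : Fin n → Fin w'.length} (h : BackForth 1 (markedWord w xs) (markedWord w' xs'))
    {i j : Fin n} (hij : xs i = xs j) : xs' i = xs' j := by
  obtain ⟨u, v, -, e⟩ := markedWord_split xs (xs i)
  obtain ⟨u', v', e', -, -⟩ := h.1 _ _ _ e
  obtain ⟨p, -, hp⟩ := exists_position e'
  have hset := Set.ext_iff.1 (Prod.ext_iff.1 hp).2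
  have hi := (hset i).1 ⟨i, rfl, rfl⟩
  have hj := (hset j).1 ⟨j, rfl, hij.symm⟩
  obtain ⟨i', hi', hpi⟩ := hi
  obtain ⟨j', hj', hpj⟩ := hj
  rw [← Fin.ext hi', ← Fin.ext hj', hpi, hpj]

theorem BackForth.get_eq {w w' : List A} {n : ℕ} {xs : Fin n → Fin w.length}
    {xs' : Fin n → Fin w'.length} (h : BackForth 1 (markedWord w xs) (markedWord w' xs'))
    (i : Fin n) : w'.get (xs' i) = w.get (xs i) := by
  obtain ⟨u, v, -, e⟩ := markedWord_split xs (xs i)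
  obtain ⟨u', v', e', -, -⟩ := h.1 _ _ _ e
  obtain ⟨p, -, hp⟩ := exists_position e'
  obtain ⟨hp1, hp2⟩ := Prod.ext_iff.1 hp
  obtain ⟨i', hi', hpi⟩ := (Set.ext_iff.1 hp2 i).1 ⟨i, rfl, rfl⟩
  rw [← Fin.ext hi', hpi]
  exact hp1.symm.trans (by rw [Fin.ext hi'])

theorem BackForth.lt_of_lt {w w' : List A} {n : ℕ} {xs : Fin n → Fin w.length}
    {xs' : Fin n → Fin w'.length} (h : BackForth 2 (markedWord w xs) (markedWord w' xs'))
    {i j : Fin n} (hij : xs i < xs j) : xs' i < xs' j := by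
  obtain ⟨u, v, hu, e⟩ := markedWord_split xs (xs j)
  obtain ⟨u', v', e', huu, -⟩ := h.1 _ _ _ e
  obtain ⟨p, hpu, hp⟩ := exists_position e'
  obtain ⟨j', hj', hpj⟩ := (Set.ext_iff.1 (Prod.ext_iff.1 hp).2 j).1 ⟨j, rfl, rfl⟩
  obtain rfl : j' = j := Fin.ext hj'
  -- the position of `i` lies in the left part `u`
  obtain ⟨s, t, hs, e2⟩ := markedWord_split xs (xs i)
  obtain ⟨r, hr⟩ : ∃ r, u = s ++ (w.get (xs i), marks xs (xs i)) :: r := by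
    rcases append_eq_append_cons (e.symm.trans e2) with ⟨r, hr, -⟩ | ⟨r, -, hr⟩
    · exact ⟨r, hr⟩
    · have := congrArg List.length hr
      rw [List.length_append, hs, hu] at this
      exact absurd hij (not_lt.2 (by simp only [Fin.le_def]; omega))
  obtain ⟨s', r', hr', -, -⟩ := huu.1 _ _ _ hr
  rw [hr', List.append_assoc] at e'
  obtain ⟨q, hqs, hq⟩ := exists_position e'
  obtain ⟨i', hi', hqi⟩ := (Set.ext_iff.1 (Prod.ext_iff.1 hq).2 i).1 ⟨i, rfl, rfl⟩
  obtain rfl : i' = i := Fin.ext hi'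
  rw [hqi, hpj, Fin.lt_def, ← hqs, ← hpu, hr']
  simp

/-- One round of the game on marked words. -/
theorem BackForth.exists_snoc {k : ℕ} {w w' : List A} {n : ℕ} {xs : Fin n → Fin w.length}
    {xs' : Fin n → Fin w'.length} (h : BackForth (k + 1) (markedWord w xs) (markedWord w' xs'))
    (p : Fin w.length) : ∃ p' : Fin w'.length,
      BackForth k (markedWord w (Fin.snoc xs p : Fin (n + 1) → _))
        (markedWord w' (Fin.snoc xs' p' : Fin (n + 1) → _)) := by
  obtain ⟨u, v, hu, e⟩ := markedWord_split xs p
  obtain ⟨u', v', e', huu, hvv⟩ := h.1 _ _ _ e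
  obtain ⟨p', hpu, hp⟩ := exists_position e'
  refine ⟨p', ?_⟩
  rw [markedWord_snoc e hu, markedWord_snoc e' hpu]
  exact huu.append (BackForth.append (w := [_]) (w' := [_]) (.refl _ _) hvv)

/-- Equivalent marked words satisfy the same formulas. -/
theorem BackForth.realize_iff {n : ℕ} (φ : (wordOrderLanguage A).BoundedFormula Empty n)
    {w w' : List A} {xs : Fin n → Fin w.length} {xs' : Fin n → Fin w'.length}
    (h : BackForth (rounds φ) (markedWord w xs) (markedWord w' xs'))
    (d : Empty → Fin w.length) (d' : Empty → Fin w'.length) :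
    φ.Realize d xs ↔ φ.Realize d' xs' := by
  induction φ with
  | falsum => exact Iff.rfl
  | equal s t =>
    rw [realize_orderEqual, realize_orderEqual]
    simp only [elim_eq_varIndex]
    exact ⟨h.of_succ.eq_of_eq, h.symm.of_succ.eq_of_eq⟩
  | rel R ts =>
    cases R with
    | lt =>
      refine realize_orderRel_lt.trans (Iff.trans ?_ realize_orderRel_lt.symm)
      simp only [elim_eq_varIndex]
      exact ⟨h.lt_of_lt, h.symm.lt_of_lt⟩
    | letter a =>
      refine realize_orderRel_letter.trans (Iff.trans ?_ realize_orderRel_letter.symm)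
      simp only [elim_eq_varIndex]
      rw [h.of_succ.get_eq]
  | imp φ ψ hφ hψ =>
    exact imp_congr (hφ (h.mono (le_max_left _ _))) (hψ (h.mono (le_max_right _ _)))
  | all φ ih =>
    rw [FirstOrder.Language.BoundedFormula.realize_all,
      FirstOrder.Language.BoundedFormula.realize_all]
    constructor
    · intro hφ p'
      obtain ⟨p, hp⟩ := h.symm.exists_snoc p'
      exact (ih hp.symm).1 (hφ p)
    · intro hφ p
      obtain ⟨p', hp⟩ := h.exists_snoc p
      exact (ih hp).2 (hφ p')

/-- A definable language does not count: from some exponent on, the powers of a factor can be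
exchanged. -/
theorem _root_.FOLtDefinable.exists_pow {L : Language A} (h : FOLtDefinable L) :
    ∃ N, ∀ x u y : List A, x ++ wordPow u N ++ y ∈ L ↔ x ++ wordPow u (N + 1) ++ y ∈ L := by
  obtain ⟨φ, hφ⟩ := h
  have hmark : ∀ (w : List A) (xs : Fin 0 → Fin w.length),
      markedWord w xs = w.map fun a => (a, ∅) := by
    intro w xs
    apply List.ext_getElem
    · simp [length_markedWord]
    · intro i h1 h2
      simp [markedWord, marks]
  refine ⟨2 ^ rounds φ, fun x u y => ?_⟩
  rw [hφ, hφ]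
  refine BackForth.realize_iff φ ?_ _ _
  rw [hmark, hmark]
  have hpow : ∀ N, (wordPow u N).map (fun a => (a, (∅ : Set ℕ))) =
      wordPow (u.map fun a => (a, (∅ : Set ℕ))) N := by
    intro N
    simp [wordPow]
  simp only [List.map_append, hpow]
  exact (BackForth.append (.refl _ _) (backForth_wordPow _ (Nat.le_succ _))).append (.refl _ _)

end WordFO

/-! ### Languages recognized by aperiodic monoids are definable -/

namespace WordFO

section Aperiodic

variable {M : Type} [Monoid M]

/-- `n` is a factor of `m`, that is, `m ∈ M n M`. -/
def IsFactor (n m : M) : Prop := ∃ x y, x * n * y = m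

theorem IsFactor.trans {n m k : M} (h : IsFactor n m) (h' : IsFactor m k) : IsFactor n k := by
  obtain ⟨x, y, rfl⟩ := h
  obtain ⟨x', y', rfl⟩ := h'
  exact ⟨x' * x, y * y', by simp only [mul_assoc]⟩

theorem IsFactor.refl (m : M) : IsFactor m m := ⟨1, 1, by simp⟩

theorem isFactor_mul_left (n m : M) : IsFactor n (m * n) := ⟨m, 1, by simp⟩

/-- In an aperiodic monoid, a factorization `m = p m q` is trivial on either side. -/
theorem mul_eq_self_of_mul_mul_eq {N : ℕ} (hN : ∀ m : M, m ^ N = m ^ (N + 1)) {p m q : M}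
    (h : p * m * q = m) : p * m = m ∧ m * q = m := by
  have hk : ∀ k, p ^ k * m * q ^ k = m := by
    intro k
    induction k with
    | zero => simp
    | succ k ih =>
      calc p ^ (k + 1) * m * q ^ (k + 1) = p ^ k * (p * m * q) * q ^ k := by
            rw [pow_succ, pow_succ']; simp only [mul_assoc]
        _ = m := by rw [h, ih]
  constructor
  · calc p * m = p * (p ^ N * m * q ^ N) := by rw [hk]
      _ = p ^ (N + 1) * m * q ^ N := by rw [pow_succ']; simp only [mul_assoc]
      _ = m := by rw [← hN, hk]
  · calc m * q = p ^ N * m * q ^ N * q := by rw [hk]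
      _ = p ^ N * m * q ^ (N + 1) := by rw [pow_succ]; simp only [mul_assoc]
      _ = m := by rw [← hN, hk]

/-- Stability: if `m ∈ n M` and `n ∈ M m M`, then `n ∈ m M`. -/
theorem right_multiple_of_isFactor {N : ℕ} (hN : ∀ m : M, m ^ N = m ^ (N + 1)) {n m r : M}
    (h : n * r = m) (h' : IsFactor m n) : ∃ s, n = m * s := by
  obtain ⟨x, y, hxy⟩ := h'
  have : x * n * (r * y) = n := by
    rw [← mul_assoc, mul_assoc x, h, hxy]
  refine ⟨y, ?_⟩
  rw [← h, mul_assoc, (mul_eq_self_of_mul_mul_eq hN this).2]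

theorem left_multiple_of_isFactor {N : ℕ} (hN : ∀ m : M, m ^ N = m ^ (N + 1)) {n m r : M}
    (h : r * n = m) (h' : IsFactor m n) : ∃ s, n = s * m := by
  obtain ⟨x, y, hxy⟩ := h'
  have : (x * r) * n * y = n := by rw [mul_assoc x, h, hxy]
  refine ⟨x, ?_⟩
  rw [← h, ← mul_assoc, (mul_eq_self_of_mul_mul_eq hN this).1]

/-- An element of `m M ∩ M m` that is a factor of `m` is equal to `m`. -/
theorem eq_of_multiples_of_isFactor {N : ℕ} (hN : ∀ m : M, m ^ N = m ^ (N + 1)) {n m r s : M}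
    (hr : n = m * r) (hs : n = s * m) (h : IsFactor n m) : n = m := by
  obtain ⟨p, q, hpq⟩ := h
  have h1 : p * s * m * q = m := by rw [mul_assoc p, ← hs, hpq]
  have h2 : p * m * (r * q) = m := by rw [mul_assoc, ← mul_assoc m, ← hr, ← mul_assoc, hpq]
  have h3 : m * q = m := (mul_eq_self_of_mul_mul_eq hN h1).2
  have h4 : m * (r * q) = m := (mul_eq_self_of_mul_mul_eq hN h2).2
  calc n = s * (m * q) := by rw [h3, hs]
    _ = m * r * q := by rw [← mul_assoc, ← hs, hr]
    _ = m := by rw [mul_assoc, h4]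

/-- The value in a monoid of a word whose letters are interpreted by `f`. -/
def wordValue {A : Type} (f : A → M) (w : List A) : M := (w.map f).prod

theorem wordValue_nil {A : Type} (f : A → M) : wordValue f [] = 1 := rfl

theorem wordValue_append {A : Type} (f : A → M) (u v : List A) :
    wordValue f (u ++ v) = wordValue f u * wordValue f v := by simp [wordValue]

theorem wordValue_cons {A : Type} (f : A → M) (a : A) (v : List A) :
    wordValue f (a :: v) = f a * wordValue f v := by simp [wordValue]

theorem exists_first_prefix {A : Type} {P : List A → Prop} (h0 : ¬ P []) {w : List A} (h : P w) :
    ∃ u a v, w = u ++ a :: v ∧ ¬ P u ∧ P (u ++ [a]) := by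
  induction w using List.reverseRecOn with
  | nil => exact absurd h h0
  | append_singleton w a ih =>
    by_cases hw : P w
    · obtain ⟨u, b, v, rfl, hu⟩ := ih hw
      exact ⟨u, b, v ++ [a], by simp, hu⟩
    · exact ⟨w, a, [], rfl, hw, h⟩

theorem exists_first_suffix {A : Type} {P : List A → Prop} (h0 : ¬ P []) {w : List A} (h : P w) :
    ∃ u a v, w = u ++ a :: v ∧ ¬ P v ∧ P (a :: v) := by
  induction w with
  | nil => exact absurd h h0
  | cons a w ih =>
    by_cases hw : P w
    · obtain ⟨u, b, v, rfl, hu⟩ := ih hw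
      exact ⟨a :: u, b, v, rfl, hu⟩
    · exact ⟨[], a, w, rfl, hw, h⟩

/-- `w` has a letter whose value is not a factor of `m`. -/
def HasBadLetter {A : Type} (f : A → M) (m : M) (w : List A) : Prop :=
  ∃ a : A, ¬ IsFactor (f a) m ∧ ∃ u v, w = u ++ a :: v

/-- `w` has a factor `a g b` whose value is not a factor of `m`, where `a`, `b` are letters and the
value of `g` is a proper factor of `m`. -/
def HasBadFactor {A : Type} (f : A → M) (m : M) (w : List A) : Prop :=
  ∃ i : A × M × A, (IsFactor i.2.1 m ∧ ¬ IsFactor m i.2.1 ∧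
    ¬ IsFactor (f i.1 * i.2.1 * f i.2.2) m) ∧
    ∃ u g v, wordValue f g = i.2.1 ∧ w = u ++ i.1 :: (g ++ i.2.2 :: v)

theorem HasBadLetter.append {A : Type} {f : A → M} {m : M} {w : List A} (h : HasBadLetter f m w)
    (x y : List A) : HasBadLetter f m (x ++ w ++ y) := by
  obtain ⟨a, ha, u, v, rfl⟩ := h
  exact ⟨a, ha, x ++ u, v ++ y, by simp⟩

theorem HasBadFactor.append {A : Type} {f : A → M} {m : M} {w : List A} (h : HasBadFactor f m w)
    (x y : List A) : HasBadFactor f m (x ++ w ++ y) := by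
  obtain ⟨i, hi, u, g, v, hg, rfl⟩ := h
  exact ⟨i, hi, x ++ u, g, v ++ y, hg, by simp⟩

/-- The value of `w` is a factor of `m` unless `w` contains one of the forbidden factors; consider
a minimal factor of `w` whose value is not a factor of `m`. -/
theorem hasBad_of_not_isFactor {A : Type} {N : ℕ} (hN : ∀ m : M, m ^ N = m ^ (N + 1)) (f : A → M)
    {m : M} (w : List A) (h : ¬ IsFactor (wordValue f w) m) :
    HasBadLetter f m w ∨ HasBadFactor f m w := by
  induction hl : w.length using Nat.strong_induction_on generalizing w with
  | _ l ih =>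
    have mono : ∀ x z y : List A, w = x ++ z ++ y → z.length < l →
        ¬ IsFactor (wordValue f z) m → HasBadLetter f m w ∨ HasBadFactor f m w := by
      rintro x z y rfl hz hzm
      exact (ih _ hz z hzm rfl).imp (fun h => h.append x y) (fun h => h.append x y)
    rcases w with _ | ⟨a, t⟩
    · exact absurd ⟨1, m, by simp [wordValue_nil]⟩ h
    · rcases List.eq_nil_or_concat t with rfl | ⟨g, b, rfl⟩
      · exact Or.inl ⟨a, by simpa [wordValue] using h, [], [], rfl⟩
      · rw [List.concat_eq_append] at *
        by_cases h1 : IsFactor (wordValue f (a :: g)) m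
        · by_cases h2 : IsFactor (wordValue f (g ++ [b])) m
          · have h3 : ¬ IsFactor (f a * wordValue f g * f b) m := by
              simpa [wordValue, mul_assoc] using h
            rw [wordValue_cons] at h1
            rw [wordValue_append] at h2
            have h4 : wordValue f [b] = f b := by simp [wordValue]
            rw [h4] at h2
            have hg : IsFactor (wordValue f g) m := (isFactor_mul_left _ _).trans h1
            refine Or.inr ⟨(a, wordValue f g, b),
              ⟨hg, fun (hm : IsFactor m (wordValue f g)) => h3 ?_, h3⟩, [], g, [], rfl, rfl⟩
            -- otherwise `n = wordValue f g` is equivalent to `m`, and `n = x a n = n b y`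
            obtain ⟨x, y, hxy⟩ := h1.trans hm
            obtain ⟨x', y', hxy'⟩ := h2.trans hm
            have e1 : x * f a * wordValue f g = wordValue f g :=
              (mul_eq_self_of_mul_mul_eq hN (by rw [mul_assoc x, hxy])).1
            have e2 : wordValue f g * (f b * y') = wordValue f g :=
              (mul_eq_self_of_mul_mul_eq hN (p := x')
                (by simpa only [mul_assoc] using hxy')).2
            refine IsFactor.trans ⟨x, y', ?_⟩ hg
            calc x * (f a * wordValue f g * f b) * y'
                = x * f a * wordValue f g * (f b * y') := by simp only [mul_assoc]
              _ = wordValue f g := by rw [e1, e2]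
          · exact mono [a] (g ++ [b]) [] (by simp) (by simp at hl ⊢; omega) h2
        · exact mono [] (a :: g) [b] (by simp) (by simp at hl ⊢; omega) h1

/-- A word `w` has value `m ≠ 1` iff its value lies in `m M`, lies in `M m`, and is a factor of `m`.
The first condition is expressed by the letter at which the value of the prefixes enters `m M`, the
second one symmetrically, and the third one by the absence of forbidden factors. The additional
conditions on `i.1` ensure that it is a proper factor of `m`. -/
theorem wordValue_eq_iff {A : Type} {N : ℕ} (hN : ∀ m : M, m ^ N = m ^ (N + 1)) (f : A → M)
    {m : M} (hm : m ≠ 1) (w : List A) :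
    wordValue f w = m ↔
      ((∃ i : M × A, ((¬ ∃ r, i.1 = m * r) ∧ (∃ r, i.1 * f i.2 = m * r) ∧
          ∃ r, i.1 * f i.2 * r = m) ∧ ∃ u, wordValue f u = i.1 ∧ ∃ v, w = u ++ i.2 :: v) ∧
        ∃ i : M × A, ((¬ ∃ r, i.1 = r * m) ∧ (∃ r, f i.2 * i.1 = r * m) ∧
          ∃ r, r * (f i.2 * i.1) = m) ∧ ∃ u v, wordValue f v = i.1 ∧ w = u ++ i.2 :: v) ∧
      ¬ HasBadLetter f m w ∧ ¬ HasBadFactor f m w := by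
  constructor
  · rintro rfl
    refine ⟨⟨?_, ?_⟩, ?_, ?_⟩
    · have h0 : ¬ ∃ r, wordValue f ([] : List A) = wordValue f w * r := by
        -- an ideal generated by `m` that contains `1` forces `m = 1`
        rintro ⟨r, hr⟩
        rw [wordValue_nil] at hr
        have := (mul_eq_self_of_mul_mul_eq hN (p := wordValue f w) (m := 1) (q := r)
          (by rw [mul_one, ← hr])).1
        apply hm
        rwa [mul_one] at this
      obtain ⟨u, a, v, hw, hu, hua⟩ := exists_first_prefix
        (P := fun u => ∃ r, wordValue f u = wordValue f w * r) (w := w) h0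
        ⟨1, by simp⟩
      refine ⟨(wordValue f u, a), ⟨hu, ?_, wordValue f v, ?_⟩, u, rfl, v, hw⟩
      · simpa [wordValue] using hua
      · rw [hw]; simp [wordValue, mul_assoc]
    · have h0 : ¬ ∃ r, wordValue f ([] : List A) = r * wordValue f w := by
        -- an ideal generated by `m` that contains `1` forces `m = 1`
        rintro ⟨r, hr⟩
        rw [wordValue_nil] at hr
        have := (mul_eq_self_of_mul_mul_eq hN (p := r) (m := 1) (q := wordValue f w)
          (by rw [mul_one, ← hr])).2
        apply hm
        rwa [one_mul] at this
      obtain ⟨u, a, v, hw, hu, hua⟩ := exists_first_suffix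
        (P := fun u => ∃ r, wordValue f u = r * wordValue f w) (w := w) h0
        ⟨1, by simp⟩
      refine ⟨(wordValue f v, a), ⟨hu, ?_, wordValue f u, ?_⟩, u, v, rfl, hw⟩
      · simpa [wordValue] using hua
      · rw [hw]; simp [wordValue]
    · rintro ⟨a, ha, u, v, hw⟩
      exact ha ⟨wordValue f u, wordValue f v, by rw [hw]; simp [wordValue, mul_assoc]⟩
    · rintro ⟨⟨a, n, b⟩, ⟨-, -, h⟩, u, g, v, hg, hw⟩
      refine h ⟨wordValue f u, wordValue f v, ?_⟩
      simp only at hg hw ⊢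
      rw [← hg]
      conv_rhs => rw [hw]
      simp [wordValue, mul_assoc]
  · rintro ⟨⟨⟨⟨n, a⟩, ⟨-, ⟨r, hr⟩, -⟩, u, hu, v, hw⟩,
      ⟨n', a'⟩, ⟨-, ⟨s, hs⟩, -⟩, u', v', hu', hw'⟩, h1, h2⟩
    have hfac : IsFactor (wordValue f w) m := by
      by_contra h
      exact (hasBad_of_not_isFactor hN f w h).elim h1 h2
    simp only at hr hs hu hu' hw hw'
    refine eq_of_multiples_of_isFactor hN (r := r * wordValue f v) (s := wordValue f u' * s) ?_ ?_
      hfac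
    · rw [hw, wordValue_append, wordValue_cons, hu, ← mul_assoc, hr, mul_assoc]
    · rw [hw', wordValue_append, wordValue_cons, hu', hs, mul_assoc]

/-- The words of value `1` are those all of whose letters have value `1`. -/
theorem wordValue_eq_one_iff {A : Type} {N : ℕ} (hN : ∀ m : M, m ^ N = m ^ (N + 1)) (f : A → M)
    (w : List A) : wordValue f w = 1 ↔ ¬ ∃ a : A, f a ≠ 1 ∧ ∃ u v, w = u ++ a :: v := by
  constructor
  · rintro h ⟨a, ha, u, v, rfl⟩
    rw [wordValue_append, wordValue_cons] at h
    have h1 := (mul_eq_self_of_mul_mul_eq hN (p := wordValue f u * f a) (m := 1)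
      (q := wordValue f v) (by rw [mul_one, mul_assoc, h])).1
    have h2 := (mul_eq_self_of_mul_mul_eq hN (p := wordValue f u) (m := 1)
      (q := f a) (by rw [mul_one, ← h1, mul_one])).2
    exact ha (by rwa [one_mul] at h2)
  · intro h
    refine List.prod_eq_one fun x hx => ?_
    obtain ⟨a, ha, rfl⟩ := List.mem_map.1 hx
    by_contra hne
    obtain ⟨u, v, rfl⟩ := List.append_of_mem ha
    exact h ⟨a, hne, u, v, rfl⟩

/-- **Schützenberger's theorem**, combined with the translation of star-free languages into
`FO(<)`: a language recognized by a finite aperiodic monoid is definable. The induction goes from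
the proper factors of `m` to `m`. -/
theorem foLtDefinable_wordValue_eq {A : Type} [Finite A] [Finite M] {N : ℕ}
    (hN : ∀ m : M, m ^ N = m ^ (N + 1)) (f : A → M) (m : M) :
    FOLtDefinable (A := A) {w | wordValue f w = m} := by
  induction hc : {n | IsFactor n m}.ncard using Nat.strong_induction_on generalizing m with
  | _ c ih =>
    have ih' : ∀ n, IsFactor n m → ¬ IsFactor m n →
        FOLtDefinable (A := A) {w | wordValue f w = n} := by
      intro n hn hm
      refine ih _ ?_ n rfl
      rw [← hc]
      refine Set.ncard_lt_ncard ⟨fun k hk => IsFactor.trans hk hn, fun hsub => hm ?_⟩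
        (Set.toFinite _)
      exact hsub (IsFactor.refl m)
    by_cases hm : m = 1
    · subst hm
      refine FOLtDefinable.congr (FOLtDefinable.compl (FOLtDefinable.exists fun a : A =>
        FOLtDefinable.and_const (f a ≠ 1) fun _ =>
          FOLtDefinable.markedProduct .univ .univ a)) fun w =>
          (wordValue_eq_one_iff hN f w).trans (not_congr ?_)
      refine exists_congr fun a => and_congr Iff.rfl ?_
      exact ⟨fun ⟨u, v, h⟩ => ⟨u, trivial, v, trivial, h⟩, fun ⟨u, _, v, _, h⟩ => ⟨u, v, h⟩⟩
    · have hU := FOLtDefinable.exists fun i : M × A =>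
        FOLtDefinable.and_const ((¬ ∃ r, i.1 = m * r) ∧ (∃ r, i.1 * f i.2 = m * r) ∧
          ∃ r, i.1 * f i.2 * r = m) fun h =>
          FOLtDefinable.markedProduct (ih' i.1 (by
            obtain ⟨-, -, r, hr⟩ := h
            exact ⟨1, f i.2 * r, by rw [← hr]; simp [mul_assoc]⟩) (fun h' => h.1 (by
            obtain ⟨-, -, r, hr⟩ := h
            exact right_multiple_of_isFactor hN (r := f i.2 * r) (by rw [← hr, mul_assoc]) h')))
            .univ i.2
      have hV := FOLtDefinable.exists fun i : M × A =>
        FOLtDefinable.and_const ((¬ ∃ r, i.1 = r * m) ∧ (∃ r, f i.2 * i.1 = r * m) ∧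
          ∃ r, r * (f i.2 * i.1) = m) fun h =>
          FOLtDefinable.markedProduct .univ (ih' i.1 (by
            obtain ⟨-, -, r, hr⟩ := h
            exact ⟨r * f i.2, 1, by rw [← hr]; simp [mul_assoc]⟩) (fun h' => h.1 (by
            obtain ⟨-, -, r, hr⟩ := h
            exact left_multiple_of_isFactor hN (r := r * f i.2) (by rw [← hr, mul_assoc]) h')))
            i.2
      have hW1 := FOLtDefinable.exists fun a : A =>
        FOLtDefinable.and_const (¬ IsFactor (f a) m) fun _ =>
          FOLtDefinable.markedProduct .univ .univ a
      have hW2 := FOLtDefinable.exists fun i : A × M × A =>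
        FOLtDefinable.and_const (IsFactor i.2.1 m ∧ ¬ IsFactor m i.2.1 ∧
          ¬ IsFactor (f i.1 * i.2.1 * f i.2.2) m) fun h =>
          FOLtDefinable.markedProduct .univ
            (FOLtDefinable.markedProduct (ih' i.2.1 h.1 h.2.1) .univ i.2.2) i.1
      refine ((hU.inter hV).inter (hW1.compl.inter hW2.compl)).congr fun w =>
        (wordValue_eq_iff hN f hm w).trans ?_
      refine and_congr (and_congr ?_ ?_) (and_congr (not_congr ?_) (not_congr ?_))
      · refine exists_congr fun i => and_congr Iff.rfl ?_
        exact ⟨fun ⟨u, hu, v, h⟩ => ⟨u, hu, v, trivial, h⟩,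
          fun ⟨u, hu, v, _, h⟩ => ⟨u, hu, v, h⟩⟩
      · refine exists_congr fun i => and_congr Iff.rfl ?_
        exact ⟨fun ⟨u, v, hv, h⟩ => ⟨u, trivial, v, hv, h⟩,
          fun ⟨u, _, v, hv, h⟩ => ⟨u, v, hv, h⟩⟩
      · refine exists_congr fun i => and_congr Iff.rfl ?_
        exact ⟨fun ⟨u, v, h⟩ => ⟨u, trivial, v, trivial, h⟩, fun ⟨u, _, v, _, h⟩ => ⟨u, v, h⟩⟩
      · refine exists_congr fun i => and_congr Iff.rfl ?_
        exact ⟨fun ⟨u, g, v, hg, h⟩ => ⟨u, trivial, _, ⟨g, hg, v, trivial, rfl⟩, h⟩,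
          fun ⟨u, _, _, ⟨g, hg, v, _, hz⟩, h⟩ => ⟨u, g, v, hg, by rw [h, hz]⟩⟩

end Aperiodic

end WordFO

/-! ### The syntactic monoid of a regular language -/

namespace WordFO

/-- The successive powers of an element of a finite aperiodic monoid agree from exponent
`|M| - 1` on. -/
theorem pow_card_pred_eq {M : Type} [Monoid M] [Finite M] {N : ℕ}
    (hN : ∀ m : M, m ^ N = m ^ (N + 1)) (m : M) : m ^ (Nat.card M - 1) = m ^ Nat.card M := by
  obtain ⟨i, j, hij, hj, h⟩ : ∃ i j, i < j ∧ j ≤ Nat.card M ∧ m ^ i = m ^ j := by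
    have hcard : Nat.card M < Nat.card (Fin (Nat.card M + 1)) := by simp
    obtain ⟨i, j, hne, h⟩ : ∃ i j : Fin (Nat.card M + 1), i ≠ j ∧ m ^ (i : ℕ) = m ^ (j : ℕ) := by
      by_contra hno
      push Not at hno
      exact absurd (Nat.card_le_card_of_injective (fun i : Fin (Nat.card M + 1) => m ^ (i : ℕ))
        fun i j hij => by_contra fun hne => hno i j hne hij) (not_le.2 hcard)
    rcases lt_or_gt_of_ne hne with hlt | hlt
    · exact ⟨i, j, hlt, by omega, h⟩
    · exact ⟨j, i, hlt, by omega, h.symm⟩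
  have hper : ∀ t, m ^ i = m ^ (i + t * (j - i)) := by
    intro t
    induction t with
    | zero => simp
    | succ t ih =>
      rw [Nat.succ_mul, ← add_assoc, pow_add, ← ih, ← pow_add, show i + (j - i) = j by omega, h]
  have hlarge : ∀ K, N ≤ K → m ^ K = m ^ (K + 1) := by
    intro K hK
    obtain ⟨r, rfl⟩ := Nat.exists_eq_add_of_le hK
    rw [pow_add, hN, ← pow_add, Nat.add_right_comm]
  have hstep : m ^ i = m ^ (i + 1) := by
    calc m ^ i = m ^ (i + N * (j - i)) := hper N
      _ = m ^ (i + N * (j - i) + 1) := hlarge _ (by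
          have := Nat.mul_le_mul_left N (show 1 ≤ j - i by omega)
          omega)
      _ = m ^ (i + 1) := by rw [pow_succ, ← hper N, ← pow_succ]
  obtain ⟨r, hr⟩ := Nat.exists_eq_add_of_le (show i ≤ Nat.card M - 1 by omega)
  have hcard : Nat.card M = i + 1 + r := by omega
  rw [hr, hcard, pow_add, hstep, ← pow_add]

variable {A : Type}

theorem coe_eq_coe_iff (L : Language A) (u v : List A) :
    ((FreeMonoid.ofList u : FreeMonoid A) : SyntacticMonoid L) =
        (FreeMonoid.ofList v : FreeMonoid A) ↔
      ∀ x y : List A, x ++ u ++ y ∈ L ↔ x ++ v ++ y ∈ L :=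
  (Con.eq _).trans Iff.rfl

theorem coe_mul_coe (L : Language A) (u v : List A) :
    ((FreeMonoid.ofList u : FreeMonoid A) : SyntacticMonoid L) *
        (FreeMonoid.ofList v : FreeMonoid A) =
      (FreeMonoid.ofList (u ++ v) : FreeMonoid A) := rfl

theorem exists_coe_eq (L : Language A) (m : SyntacticMonoid L) :
    ∃ u : List A, ((FreeMonoid.ofList u : FreeMonoid A) : SyntacticMonoid L) = m := by
  induction m using Con.induction_on with
  | _ u => exact ⟨u.toList, rfl⟩

/-- The action of a word on the left quotients of a language. -/
def quotientAction (L : Language A) (u : List A) :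
    Set.range L.leftQuotient → Set.range L.leftQuotient :=
  fun q => L.toDFA.evalFrom q u

theorem coe_evalFrom_toDFA (L : Language A) (q : Set.range L.leftQuotient) (u : List A) :
    (L.toDFA.evalFrom q u : Language A) = (q : Language A).leftQuotient u := by
  induction u using List.reverseRecOn with
  | nil => rfl
  | append_singleton u a ih =>
    rw [DFA.evalFrom_append_singleton, Language.step_toDFA, ih, Language.leftQuotient_append]

/-- The syntactic monoid is the transition monoid of the minimal automaton. -/
theorem quotientAction_eq_iff (L : Language A) (u v : List A) :
    quotientAction L u = quotientAction L v ↔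
      ∀ x y : List A, x ++ u ++ y ∈ L ↔ x ++ v ++ y ∈ L := by
  constructor
  · intro h x y
    have hx := congrArg Subtype.val (congrFun h ⟨L.leftQuotient x, x, rfl⟩)
    simp only [quotientAction, coe_evalFrom_toDFA, ← Language.leftQuotient_append] at hx
    exact Set.ext_iff.1 hx y
  · intro h
    funext ⟨q, x, hx⟩
    apply Subtype.ext
    simp only [quotientAction, coe_evalFrom_toDFA]
    rw [← hx, ← Language.leftQuotient_append, ← Language.leftQuotient_append]
    exact Set.ext fun y => h x y

theorem finite_syntacticMonoid {L : Language A} (hL : L.IsRegular) :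
    Finite (SyntacticMonoid L) := by
  have := hL.finite_range_leftQuotient.to_subtype
  choose f hf using exists_coe_eq L
  refine Finite.of_injective (fun m => quotientAction L (f m)) fun m m' h => ?_
  rw [← hf m, ← hf m', coe_eq_coe_iff]
  exact (quotientAction_eq_iff L _ _).1 h

theorem coe_wordPow (L : Language A) (u : List A) (N : ℕ) :
    ((FreeMonoid.ofList (wordPow u N) : FreeMonoid A) : SyntacticMonoid L) =
      ((FreeMonoid.ofList u : FreeMonoid A) : SyntacticMonoid L) ^ N := by
  induction N with
  | zero => rw [pow_zero]; rfl
  | succ N ih => rw [wordPow_add, ← coe_mul_coe, wordPow_one, ih, pow_succ]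

theorem wordValue_coe (L : Language A) (w : List A) :
    wordValue (fun a => ((FreeMonoid.ofList [a] : FreeMonoid A) : SyntacticMonoid L)) w =
      (FreeMonoid.ofList w : FreeMonoid A) := by
  induction w with
  | nil => rfl
  | cons a w ih => rw [wordValue_cons, ih, coe_mul_coe, List.singleton_append]

/-- A regular language is definable iff its syntactic monoid is aperiodic. -/
theorem foDefinable_iff_pow_eq [Finite A] {L : Language A} (hL : L.IsRegular) :
    FODefinable L ↔ ∀ m : SyntacticMonoid L,
      m ^ (Nat.card (SyntacticMonoid L) - 1) = m ^ Nat.card (SyntacticMonoid L) := by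
  have := finite_syntacticMonoid hL
  rw [foDefinable_iff_foLtDefinable]
  constructor
  · intro h
    obtain ⟨N, hN⟩ := h.exists_pow
    refine pow_card_pred_eq (N := N) fun m => ?_
    obtain ⟨u, rfl⟩ := exists_coe_eq L m
    rw [← coe_wordPow, ← coe_wordPow, coe_eq_coe_iff]
    exact fun x y => hN x u y
  · intro h
    have hcard : Nat.card (SyntacticMonoid L) - 1 + 1 = Nat.card (SyntacticMonoid L) :=
      Nat.sub_add_cancel Nat.card_pos
    rw [← hcard, Nat.add_sub_cancel] at h
    refine (FOLtDefinable.exists fun m : SyntacticMonoid L => FOLtDefinable.and_const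
      (∃ u : List A, u ∈ L ∧ ((FreeMonoid.ofList u : FreeMonoid A) : SyntacticMonoid L) = m)
      fun _ => foLtDefinable_wordValue_eq h
        (fun a => ((FreeMonoid.ofList [a] : FreeMonoid A) : SyntacticMonoid L)) m).congr fun w => ?_
    constructor
    · exact fun hw => ⟨_, ⟨w, hw, rfl⟩, wordValue_coe L w⟩
    · rintro ⟨m, ⟨u, hu, rfl⟩, hw⟩
      have := (coe_eq_coe_iff L w u).1 ((wordValue_coe L w).symm.trans hw) [] []
      simpa using this.2 (by simpa using hu)

end WordFO

/-! ### Short words suffice -/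

namespace WordFO

variable {A : Type}

/-- If `f` is compatible with appending words on the right and takes finitely many values, then each
value is taken at a short word: a repetition among the prefixes of a long word can be cut out. -/
theorem exists_short_word {β : Type} [Finite β] (f : List A → β)
    (hf : ∀ u v z, f u = f v → f (u ++ z) = f (v ++ z)) (w : List A) :
    ∃ u, u.length ≤ Nat.card β ∧ f u = f w := by
  induction hl : w.length using Nat.strong_induction_on generalizing w with
  | _ l ih =>
    by_cases hw : w.length ≤ Nat.card β
    · exact ⟨w, hw, rfl⟩
    obtain ⟨i, j, hij, hj, h⟩ : ∃ i j, i < j ∧ j ≤ w.length ∧ f (w.take i) = f (w.take j) := by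
      obtain ⟨i, j, hne, h⟩ : ∃ i j : Fin (w.length + 1), i ≠ j ∧
          f (w.take i) = f (w.take j) := by
        by_contra hno
        push Not at hno
        have := Nat.card_le_card_of_injective (fun i : Fin (w.length + 1) => f (w.take i))
          fun i j hij => by_contra fun hne => hno i j hne hij
        simp at this
        omega
      rcases lt_or_gt_of_ne hne with hlt | hlt
      · exact ⟨i, j, hlt, by omega, h⟩
      · exact ⟨j, i, hlt, by omega, h.symm⟩
    have hcut := hf _ _ (w.drop j) h
    rw [List.take_append_drop] at hcut
    obtain ⟨u, hu, hfu⟩ := ih (w.take i ++ w.drop j).length (by simp; omega) _ rfl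
    exact ⟨u, hu, hfu.trans hcut⟩

theorem exists_short_word_left {β : Type} [Finite β] (f : List A → β)
    (hf : ∀ u v z, f u = f v → f (z ++ u) = f (z ++ v)) (w : List A) :
    ∃ u, u.length ≤ Nat.card β ∧ f u = f w := by
  obtain ⟨u, hu, h⟩ := exists_short_word (fun w => f w.reverse)
    (fun u v z h => by simpa using hf _ _ z.reverse h) w.reverse
  exact ⟨u.reverse, by simpa using hu, by simpa using h⟩

theorem card_set_eq (ι : Type) [Finite ι] : Nat.card (Set ι) = 2 ^ Nat.card ι := by
  have := Fintype.ofFinite ι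
  simp [Nat.card_eq_fintype_card]

/-- `L` has at most `Q` left quotients. -/
def QuotientBound (L : Language A) (Q : ℕ) : Prop :=
  (Set.range L.leftQuotient).Finite ∧ Nat.card (Set.range L.leftQuotient) ≤ Q

/-- A length up to which words have to be examined for a language with at most `Q` left quotients:
it bounds the number of left quotients, of sets of left quotients, and of maps between them. -/
def lengthBound (Q : ℕ) : ℕ := 2 ^ (Q * Q)

section

variable {L : Language A} {Q : ℕ}

theorem QuotientBound.exists_leftQuotient_eq (h : QuotientBound L Q) (w : List A) :
    ∃ u, u.length ≤ lengthBound Q ∧ L.leftQuotient u = L.leftQuotient w := by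
  have := h.1.to_subtype
  obtain ⟨u, hu, e⟩ := exists_short_word
    (fun u => (⟨L.leftQuotient u, u, rfl⟩ : Set.range L.leftQuotient)) (fun u v z e => by
      have := congrArg Subtype.val e
      simp only at this
      apply Subtype.ext
      simp only [Language.leftQuotient_append, this]) w
  refine ⟨u, (hu.trans h.2).trans ?_, congrArg Subtype.val e⟩
  exact Nat.lt_two_pow_self.le.trans (Nat.pow_le_pow_right two_pos (Nat.le_mul_self Q))

theorem QuotientBound.exists_mem_iff (h : QuotientBound L Q) (z : List A) :
    ∃ z', z'.length ≤ lengthBound Q ∧ ∀ u, u ++ z' ∈ L ↔ u ++ z ∈ L := by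
  have := h.1.to_subtype
  obtain ⟨z', hz, e⟩ := exists_short_word_left
    (fun z => {q : Set.range L.leftQuotient | z ∈ (q : Language A)}) (fun u v z e => by
      ext ⟨q, y, hq⟩
      have := Set.ext_iff.1 e ⟨L.leftQuotient (y ++ z), y ++ z, rfl⟩
      simpa [← hq] using this) z
  refine ⟨z', hz.trans ?_, fun u => Set.ext_iff.1 e ⟨L.leftQuotient u, u, rfl⟩⟩
  rw [card_set_eq]
  exact Nat.pow_le_pow_right two_pos (h.2.trans (Nat.le_mul_self Q))

theorem QuotientBound.exists_quotientAction_eq (h : QuotientBound L Q) (w : List A) :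
    ∃ u, u.length ≤ lengthBound Q ∧ quotientAction L u = quotientAction L w := by
  have := h.1.to_subtype
  obtain ⟨u, hu, e⟩ := exists_short_word (quotientAction L) (fun u v z e => by
    funext q
    have := congrFun e q
    simp only [quotientAction, DFA.evalFrom_of_append] at this ⊢
    rw [this]) w
  refine ⟨u, hu.trans ?_, e⟩
  have hpos : 0 < Nat.card (Set.range L.leftQuotient) := by
    have : Nonempty (Set.range L.leftQuotient) := ⟨⟨_, [], rfl⟩⟩
    exact Nat.card_pos
  rw [Nat.card_fun, lengthBound, pow_mul]
  exact (Nat.pow_le_pow_left (h.2.trans Nat.lt_two_pow_self.le) _).trans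
    (Nat.pow_le_pow_right (Nat.two_pow_pos Q) h.2)

end

/-! ### Bounds for the number of left quotients -/

/-- If each left quotient of `L` is the value of `f` at some parameter, the number of parameters is
a bound. -/
theorem quotientBound_of_surj {L : Language A} {ι : Type} [Finite ι] (f : ι → Language A)
    (h : ∀ u, ∃ i, L.leftQuotient u = f i) {Q : ℕ} (hQ : Nat.card ι ≤ Q) : QuotientBound L Q := by
  have hsub : Set.range L.leftQuotient ⊆ Set.range f := by
    rintro _ ⟨u, rfl⟩
    obtain ⟨i, hi⟩ := h u
    exact ⟨i, hi.symm⟩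
  refine ⟨(Set.finite_range f).subset hsub, ?_⟩
  have := (Set.finite_range f).to_subtype
  exact ((Nat.card_mono (Set.finite_range f) hsub).trans
    (Nat.card_le_card_of_surjective _ Set.rangeFactorization_surjective)).trans hQ

theorem quotientBound_nfa {k : ℕ} (M : NFA A (Fin k)) : QuotientBound M.accepts (2 ^ k) := by
  refine quotientBound_of_surj (fun S : Set (Fin k) => M.acceptsFrom S)
    (fun u => ⟨M.eval u, ?_⟩) (by rw [card_set_eq, Nat.card_fin])
  ext v
  exact M.append_mem_acceptsFrom

theorem quotientBound_zero : QuotientBound (0 : Language A) 1 := by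
  refine quotientBound_of_surj (fun _ : Unit => 0) (fun u => ⟨(), ?_⟩) (by simp)
  ext v
  exact Iff.rfl

theorem quotientBound_one : QuotientBound (1 : Language A) 2 := by
  refine quotientBound_of_surj (fun b : Bool => if b then 1 else 0) (fun u => ?_) (by simp)
  cases u with
  | nil => exact ⟨true, rfl⟩
  | cons a u =>
    refine ⟨false, ?_⟩
    ext v
    simp [Language.mem_one, Language.notMem_zero]

theorem quotientBound_char (a : A) : QuotientBound ({[a]} : Language A) 3 := by
  refine quotientBound_of_surj (fun i : Fin 3 => if i = 0 then {[a]} else if i = 1 then 1 else 0)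
    (fun u => ?_) (by simp)
  have hmem : ∀ w : List A, w ∈ ({[a]} : Language A) ↔ w = [a] := fun w => Iff.rfl
  rcases u with _ | ⟨b, _ | ⟨c, u⟩⟩
  · exact ⟨0, rfl⟩
  · by_cases h : b = a
    · refine ⟨1, ?_⟩
      ext v
      simp [hmem, h, Language.mem_one]
    · refine ⟨2, ?_⟩
      ext v
      simp [hmem, h, Language.notMem_zero]
  · refine ⟨2, ?_⟩
    ext v
    simp [hmem, Language.notMem_zero]

theorem QuotientBound.add {L K : Language A} {Q R : ℕ} (h : QuotientBound L Q)
    (k : QuotientBound K R) : QuotientBound (L + K) (Q * R) := by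
  have := h.1.to_subtype
  have := k.1.to_subtype
  refine quotientBound_of_surj (fun i : Set.range L.leftQuotient × Set.range K.leftQuotient =>
    (i.1 : Language A) + (i.2 : Language A)) (fun u => ⟨(⟨_, u, rfl⟩, ⟨_, u, rfl⟩), ?_⟩) ?_
  · ext v
    simp [Language.mem_add]
  · rw [Nat.card_prod]
    exact Nat.mul_le_mul h.2 k.2

/-- The union of a set of left quotients. -/
def unionOf {K : Language A} (S : Set (Set.range K.leftQuotient)) : Language A :=
  {w | ∃ q ∈ S, w ∈ (q : Language A)}

/-- A left quotient of `L K` is the union of `(u⁻¹L) K` and of left quotients of `K`. -/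
theorem QuotientBound.mul {L K : Language A} {Q R : ℕ} (h : QuotientBound L Q)
    (k : QuotientBound K R) : QuotientBound (L * K) (Q * 2 ^ R) := by
  have := h.1.to_subtype
  have := k.1.to_subtype
  refine quotientBound_of_surj
    (fun i : Set.range L.leftQuotient × Set (Set.range K.leftQuotient) =>
      (i.1 : Language A) * K + unionOf i.2)
    (fun u => ⟨(⟨_, u, rfl⟩, {q | ∃ x y, u = x ++ y ∧ x ∈ L ∧
      (q : Language A) = K.leftQuotient y}), ?_⟩) ?_
  · ext v
    rw [Language.mem_leftQuotient, Language.mem_mul, Language.mem_add, Language.mem_mul]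
    constructor
    · rintro ⟨a, ha, b, hb, hab⟩
      rcases List.append_eq_append_iff.1 hab with ⟨t, ht, ht'⟩ | ⟨t, ht, ht'⟩
      · exact Or.inr ⟨⟨K.leftQuotient t, t, rfl⟩, ⟨a, t, ht, ha, rfl⟩,
          (Language.mem_leftQuotient _ _).2 (ht' ▸ hb)⟩
      · exact Or.inl ⟨t, (Language.mem_leftQuotient _ _).2 (ht ▸ ha), b, hb, ht'.symm⟩
    · rintro (⟨a, ha, b, hb, rfl⟩ | ⟨q, ⟨x, y, hu, hx, hq⟩, hv⟩)
      · exact ⟨u ++ a, ha, b, hb, by simp⟩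
      · rw [hq] at hv
        exact ⟨x, hx, y ++ v, hv, by simp [hu]⟩
  · rw [Nat.card_prod, card_set_eq]
    exact Nat.mul_le_mul h.2 (Nat.pow_le_pow_right two_pos k.2)

/-- If `u v` is a product of words of `L` and `u` is nonempty, then one of these words is `y a`,
where `u` ends in `y` and `v` begins with `a`; it is preceded and followed by products of words
of `L`. -/
theorem append_mem_kstar_iff {L : Language A} {u : List A} (hu : u ≠ []) (v : List A) :
    u ++ v ∈ KStar.kstar L ↔
      ∃ x y, u = x ++ y ∧ x ∈ KStar.kstar L ∧ v ∈ L.leftQuotient y * KStar.kstar L := by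
  constructor
  · rintro ⟨S, hS, hL⟩
    induction S generalizing u with
    | nil => simp at hS; exact absurd hS.1 hu
    | cons s S ih =>
      rw [List.flatten_cons] at hS
      have hS' : S.flatten ∈ KStar.kstar L :=
        Language.join_mem_kstar fun y hy => hL y (List.mem_cons_of_mem _ hy)
      rcases List.append_eq_append_iff.1 hS with ⟨t, ht, ht'⟩ | ⟨t, ht, ht'⟩
      · exact ⟨[], u, rfl, Language.nil_mem_kstar _, Language.mem_mul.2
          ⟨t, (Language.mem_leftQuotient _ _).2 (ht ▸ hL s (by simp)), _, hS', ht'.symm⟩⟩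
      · by_cases h0 : t = []
        · subst h0
          refine ⟨[], u, rfl, Language.nil_mem_kstar _, Language.mem_mul.2
            ⟨[], (Language.mem_leftQuotient _ _).2 ?_, v, ?_, rfl⟩⟩
          · rw [List.append_nil] at ht ⊢
            exact ht ▸ hL s (by simp)
          · rw [List.nil_append] at ht'
            exact ht' ▸ hS'
        · obtain ⟨x, y, hxy, hx, hv⟩ := ih h0 ht'.symm fun y hy => hL y (List.mem_cons_of_mem _ hy)
          refine ⟨s ++ x, y, by rw [ht, hxy]; simp, ?_, hv⟩
          obtain ⟨S', rfl, hS'⟩ := hx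
          exact ⟨s :: S', rfl, by
            intro z hz
            rcases List.mem_cons.1 hz with rfl | hz
            · exact hL _ (by simp)
            · exact hS' z hz⟩
  · rintro ⟨x, y, rfl, ⟨S, rfl, hS⟩, hv⟩
    obtain ⟨a, ha, b, ⟨S', rfl, hS'⟩, rfl⟩ := Language.mem_mul.1 hv
    refine ⟨S ++ (y ++ a) :: S', by simp, fun z hz => ?_⟩
    rcases List.mem_append.1 hz with hz | hz
    · exact hS z hz
    · rcases List.mem_cons.1 hz with rfl | hz
      · exact ha
      · exact hS' z hz

theorem QuotientBound.kstar {L : Language A} {Q : ℕ} (h : QuotientBound L Q) :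
    QuotientBound (KStar.kstar L) (2 ^ Q + 1) := by
  have := h.1.to_subtype
  refine quotientBound_of_surj (fun i : Option (Set (Set.range L.leftQuotient)) =>
    i.elim (KStar.kstar L) fun S => {w | ∃ q ∈ S, w ∈ (q : Language A) * KStar.kstar L})
    (fun u => ?_) ?_
  · by_cases hu : u = []
    · exact ⟨none, by rw [hu]; rfl⟩
    · refine ⟨some {q | ∃ x y, u = x ++ y ∧ x ∈ KStar.kstar L ∧
        (q : Language A) = L.leftQuotient y}, ?_⟩
      ext v
      rw [Language.mem_leftQuotient, append_mem_kstar_iff hu]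
      constructor
      · rintro ⟨x, y, hxy, hx, hv⟩
        exact ⟨⟨_, y, rfl⟩, ⟨x, y, hxy, hx, rfl⟩, hv⟩
      · rintro ⟨q, ⟨x, y, hxy, hx, hq⟩, hv⟩
        exact ⟨x, y, hxy, hx, hq ▸ hv⟩
  · rw [Finite.card_option, card_set_eq]
    exact Nat.succ_le_succ (Nat.pow_le_pow_right two_pos h.2)

end WordFO

/-! ### The minimal automaton and the multiplication table from a membership test

Words are handled as lists of natural numbers, so that the alphabet size can be part of the input.
-/

namespace WordFO

/-- The words of length at most `N` with letters `0, …, n - 1`. -/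
def shortWords (n N : ℕ) : List (List ℕ) :=
  Nat.rec [[]] (fun _ W => [] :: W.flatMap fun w => (List.range n).map fun a => a :: w) N

theorem mem_shortWords {n N : ℕ} {w : List ℕ} :
    w ∈ shortWords n N ↔ w.length ≤ N ∧ ∀ a ∈ w, a < n := by
  induction N generalizing w with
  | zero => simp +contextual [shortWords]
  | succ N ih =>
    change w ∈ [] :: (shortWords n N).flatMap _ ↔ _
    cases w with
    | nil => simp
    | cons a w =>
      simp [ih]
      tauto

/-- A list of representatives of the classes that an equivalence relation has on a list. -/
def representatives {β : Type} (E : β → β → Bool) (W : List β) : List β :=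
  W.foldr (fun w R => if R.any fun r => E r w then R else w :: R) []

section Representatives

variable {β : Type} {E : β → β → Bool} {W : List β}

theorem representatives_cons (w : β) : representatives E (w :: W) =
    if (representatives E W).any fun r => E r w then representatives E W
    else w :: representatives E W := rfl

theorem mem_of_mem_representatives {w : β} (h : w ∈ representatives E W) : w ∈ W := by
  induction W with
  | nil => exact h
  | cons v W ih =>
    rw [representatives_cons] at h
    split at h
    · exact List.mem_cons_of_mem _ (ih h)
    · rcases List.mem_cons.1 h with rfl | h
      · exact List.mem_cons_self
      · exact List.mem_cons_of_mem _ (ih h)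

theorem exists_mem_representatives (hE : ∀ w ∈ W, E w w = true) {w : β} (h : w ∈ W) :
    ∃ r ∈ representatives E W, E r w = true := by
  induction W with
  | nil => simp at h
  | cons v W ih =>
    rw [representatives_cons]
    rcases List.mem_cons.1 h with rfl | h
    · split
      · rename_i h
        simpa using h
      · exact ⟨w, List.mem_cons_self, hE w List.mem_cons_self⟩
    · obtain ⟨r, hr, e⟩ := ih (fun z hz => hE z (List.mem_cons_of_mem _ hz)) h
      split
      · exact ⟨r, hr, e⟩
      · exact ⟨r, List.mem_cons_of_mem _ hr, e⟩

theorem pairwise_representatives :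
    (representatives E W).Pairwise fun r s => ¬ E s r = true := by
  induction W with
  | nil => exact List.Pairwise.nil
  | cons w W ih =>
    rw [representatives_cons]
    split
    · exact ih
    · rename_i h
      simp only [List.any_eq_true, not_exists, not_and] at h
      exact List.pairwise_cons.2 ⟨h, ih⟩

end Representatives

/-- Equality of the left quotients of `u` and `v`, tested on the words in `W`. -/
def leftEq (mem : List ℕ → Bool) (W : List (List ℕ)) (u v : List ℕ) : Bool :=
  W.all fun z => mem (u ++ z) == mem (v ++ z)

/-- The syntactic equivalence of `u` and `v`, tested on contexts from `W`. -/
def contextEq (mem : List ℕ → Bool) (W : List (List ℕ)) (u v : List ℕ) : Bool :=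
  W.all fun x => W.all fun z => mem (x ++ (u ++ z)) == mem (x ++ (v ++ z))

/-- The automaton over `0, …, n - 1` whose states are the words in `R`, seen as representatives of
left quotients. -/
def quotientAutomaton (n : ℕ) (mem : List ℕ → Bool) (W R : List (List ℕ)) : AutomatonData :=
  (R.length,
    (List.range R.length).flatMap fun p => (List.range n).flatMap fun a =>
      ((List.range R.length).filter fun q =>
        leftEq mem W (R.getD p [] ++ [a]) (R.getD q [])).map fun q => (p, a, q),
    (List.range R.length).filter fun q => leftEq mem W [] (R.getD q []),
    (List.range R.length).filter fun q => mem (R.getD q []))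

/-- The minimal automaton of the language with membership test `mem`, computed from the words of
length at most `N`. -/
def minimalAutomaton (n N : ℕ) (mem : List ℕ → Bool) : AutomatonData :=
  quotientAutomaton n mem (shortWords n N)
    (representatives (leftEq mem (shortWords n N)) (shortWords n N))

/-- The multiplication table of the classes represented by the words in `R`. -/
def classTable (mem : List ℕ → Bool) (W R : List (List ℕ)) : List (List ℕ) :=
  R.map fun u => R.map fun v => R.findIdx fun r => contextEq mem W r (u ++ v)

/-- The multiplication table of the syntactic monoid of the language with membership test `mem`,
computed from the words of length at most `N`. -/
def syntacticTable (n N : ℕ) (mem : List ℕ → Bool) : List (List ℕ) :=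
  classTable mem (shortWords n N)
    (representatives (contextEq mem (shortWords n N)) (shortWords n N))

/-- A word over `Fin n` as a list of natural numbers. -/
def wordVal {n : ℕ} (w : List (Fin n)) : List ℕ := w.map Fin.val

theorem wordVal_append {n : ℕ} (u v : List (Fin n)) : wordVal (u ++ v) = wordVal u ++ wordVal v :=
  List.map_append

theorem exists_wordVal_eq {n : ℕ} {w : List ℕ} (h : ∀ a ∈ w, a < n) :
    ∃ u : List (Fin n), wordVal u = w := by
  induction w with
  | nil => exact ⟨[], rfl⟩
  | cons a w ih =>
    obtain ⟨u, rfl⟩ := ih fun b hb => h b (List.mem_cons_of_mem _ hb)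
    exact ⟨⟨a, h a List.mem_cons_self⟩ :: u, rfl⟩

theorem wordVal_mem_shortWords {n N : ℕ} {u : List (Fin n)} :
    wordVal u ∈ shortWords n N ↔ u.length ≤ N := by
  rw [mem_shortWords]
  simp [wordVal]

/-- `mem` is a membership test for the language `L`. -/
def IsMembershipTest {n : ℕ} (mem : List ℕ → Bool) (L : Language (Fin n)) : Prop :=
  ∀ w : List (Fin n), mem (wordVal w) = true ↔ w ∈ L

section Correctness

variable {n Q : ℕ} {L : Language (Fin n)} {mem : List ℕ → Bool}

theorem leftEq_iff (hmem : IsMembershipTest mem L) (hQ : QuotientBound L Q)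
    (u v : List (Fin n)) :
    leftEq mem (shortWords n (lengthBound Q)) (wordVal u) (wordVal v) = true ↔
      L.leftQuotient u = L.leftQuotient v := by
  rw [leftEq, List.all_eq_true]
  have key : ∀ z : List (Fin n), (mem (wordVal u ++ wordVal z) == mem (wordVal v ++ wordVal z)) =
      true ↔ (u ++ z ∈ L ↔ v ++ z ∈ L) := by
    intro z
    rw [← wordVal_append, ← wordVal_append, ← hmem, ← hmem, beq_iff_eq, Bool.eq_iff_iff]
  constructor
  · intro h
    ext z
    obtain ⟨z', hz', e⟩ := hQ.exists_mem_iff z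
    rw [Language.mem_leftQuotient, Language.mem_leftQuotient, ← e, ← e]
    exact (key z').1 (h _ (wordVal_mem_shortWords.2 hz'))
  · intro h z hz
    obtain ⟨z, rfl⟩ := exists_wordVal_eq (mem_shortWords.1 hz).2
    exact (key z).2 (Set.ext_iff.1 h z)

theorem contextEq_iff (hmem : IsMembershipTest mem L) (hQ : QuotientBound L Q)
    (u v : List (Fin n)) :
    contextEq mem (shortWords n (lengthBound Q)) (wordVal u) (wordVal v) = true ↔
      ((FreeMonoid.ofList u : FreeMonoid (Fin n)) : SyntacticMonoid L) =
        (FreeMonoid.ofList v : FreeMonoid (Fin n)) := by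
  rw [contextEq, List.all_eq_true, coe_eq_coe_iff]
  have key : ∀ x z : List (Fin n), (mem (wordVal x ++ (wordVal u ++ wordVal z)) ==
      mem (wordVal x ++ (wordVal v ++ wordVal z))) = true ↔
      (x ++ u ++ z ∈ L ↔ x ++ v ++ z ∈ L) := by
    intro x z
    rw [← wordVal_append, ← wordVal_append, ← wordVal_append, ← wordVal_append,
      List.append_assoc x, List.append_assoc x, ← hmem, ← hmem, beq_iff_eq, Bool.eq_iff_iff]
  constructor
  · intro h x z
    obtain ⟨x', hx', ex⟩ := hQ.exists_leftQuotient_eq x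
    obtain ⟨z', hz', ez⟩ := hQ.exists_mem_iff z
    have hx : ∀ y, x ++ y ∈ L ↔ x' ++ y ∈ L := fun y => (Set.ext_iff.1 ex y).symm
    rw [List.append_assoc, List.append_assoc, hx, hx, ← List.append_assoc, ← List.append_assoc,
      ← ez, ← ez]
    exact (key x' z').1 (List.all_eq_true.1 (h _ (wordVal_mem_shortWords.2 hx')) _
      (wordVal_mem_shortWords.2 hz'))
  · intro h x hx
    obtain ⟨x, rfl⟩ := exists_wordVal_eq (mem_shortWords.1 hx).2
    rw [List.all_eq_true]
    intro z hz
    obtain ⟨z, rfl⟩ := exists_wordVal_eq (mem_shortWords.1 hz).2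
    exact (key x z).2 (h x z)

/-- If `E` tests the equality of the values of `F` and each value of `F` is taken at a short word,
then the representatives enumerate the values of `F`. -/
theorem exists_equiv_of_representatives {γ : Type} (F : List (Fin n) → γ)
    {E : List ℕ → List ℕ → Bool} {N : ℕ} (hE : ∀ u v, E (wordVal u) (wordVal v) = true ↔ F u = F v)
    (hN : ∀ w, ∃ u : List (Fin n), u.length ≤ N ∧ F u = F w) (hsurj : Function.Surjective F)
    {R : List (List ℕ)} (hR : R = representatives E (shortWords n N)) :
    ∃ (e : Fin R.length ≃ γ) (u : Fin R.length → List (Fin n)),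
      (∀ i : Fin R.length, R.getD i [] = wordVal (u i)) ∧ ∀ i, e i = F (u i) := by
  have hword : ∀ i : Fin R.length, ∃ u : List (Fin n), R.getD i [] = wordVal u := by
    intro i
    have hi : R[i] ∈ shortWords n N := mem_of_mem_representatives (E := E) (by
      rw [← hR]; exact List.getElem_mem _)
    obtain ⟨u, hu⟩ := exists_wordVal_eq (mem_shortWords.1 hi).2
    exact ⟨u, by rw [hu]; simp⟩
  choose u hu using hword
  refine ⟨Equiv.ofBijective (fun i => F (u i)) ⟨?_, ?_⟩, u, hu, fun i => rfl⟩
  · have hpair := pairwise_representatives (E := E) (W := shortWords n N)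
    rw [← hR, List.pairwise_iff_getElem] at hpair
    have hne : ∀ i j : Fin R.length, i < j → F (u i) ≠ F (u j) := by
      intro i j hij e
      refine hpair i j i.2 j.2 hij ?_
      have hi := hu i
      have hj := hu j
      simp only [List.getD_eq_getElem _ _ (Fin.is_lt _)] at hi hj
      rw [hi, hj, hE]
      exact e.symm
    intro i j e
    rcases lt_trichotomy i j with h | h | h
    · exact absurd e (hne i j h)
    · exact h
    · exact absurd e.symm (hne j i h)
  · intro c
    obtain ⟨w, rfl⟩ := hsurj c
    obtain ⟨v, hv, e⟩ := hN w
    obtain ⟨r, hr, h⟩ := exists_mem_representatives (E := E) (W := shortWords n N) (fun z hz => by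
      obtain ⟨z, rfl⟩ := exists_wordVal_eq (mem_shortWords.1 hz).2
      exact (hE z z).2 rfl) (wordVal_mem_shortWords.2 hv)
    obtain ⟨v', rfl⟩ := exists_wordVal_eq (mem_shortWords.1 (mem_of_mem_representatives hr)).2
    have hv' : F v' = F v := (hE v' v).1 h
    rw [← hR] at hr
    obtain ⟨i, hi, hget⟩ := List.getElem_of_mem hr
    refine ⟨⟨i, hi⟩, ?_⟩
    have := hu ⟨i, hi⟩
    simp only [List.getD_eq_getElem _ _ hi, hget] at this
    have huv : v' = u ⟨i, hi⟩ := List.map_injective_iff.2 Fin.val_injective this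
    change F (u ⟨i, hi⟩) = F w
    rw [← huv, hv', e]

theorem isMinimalAutomaton_minimalAutomaton (hmem : IsMembershipTest mem L)
    (hQ : QuotientBound L Q) :
    IsMinimalAutomaton n (minimalAutomaton n (lengthBound Q) mem) L := by
  obtain ⟨R, hR⟩ : ∃ R, R = representatives (leftEq mem (shortWords n (lengthBound Q)))
    (shortWords n (lengthBound Q)) := ⟨_, rfl⟩
  obtain ⟨e, u, hu, he⟩ := exists_equiv_of_representatives
    (fun u => (⟨L.leftQuotient u, u, rfl⟩ : Set.range L.leftQuotient)) (N := lengthBound Q)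
    (fun u v => (leftEq_iff hmem hQ u v).trans
      ⟨fun h => Subtype.ext h, fun h => congrArg Subtype.val h⟩)
    (fun w => by
      obtain ⟨u, h, h'⟩ := hQ.exists_leftQuotient_eq w
      exact ⟨u, h, Subtype.ext h'⟩) (by rintro ⟨_, u, rfl⟩; exact ⟨u, rfl⟩) hR
  have he' : ∀ i, (e i : Language (Fin n)) = L.leftQuotient (u i) :=
    fun i => congrArg Subtype.val (he i)
  rw [minimalAutomaton, ← hR]
  refine ⟨e, fun (p : Fin R.length) a (q : Fin R.length) => ?_, fun (q : Fin R.length) => ?_,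
    fun (q : Fin R.length) => ?_⟩
  · have hstep : L.toDFA.step (e p) a = e q ↔
        leftEq mem (shortWords n (lengthBound Q)) (R.getD p [] ++ [(a : ℕ)]) (R.getD q []) =
          true := by
      rw [hu, hu, show wordVal (u p) ++ [(a : ℕ)] = wordVal (u p ++ [a]) from
        (wordVal_append (u p) [a]).symm, leftEq_iff hmem hQ, ← Subtype.coe_inj,
        Language.step_toDFA, he', he', Language.leftQuotient_append]
    refine Iff.trans ?_ hstep.symm
    change ((p : ℕ), (a : ℕ), (q : ℕ)) ∈ List.flatMap _ _ ↔ _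
    simp only [List.mem_flatMap, List.mem_map, List.mem_filter, List.mem_range, Prod.mk.injEq]
    constructor
    · rintro ⟨p', -, a', -, q', ⟨-, h⟩, rfl, rfl, rfl⟩
      exact h
    · exact fun h => ⟨p, p.2, a, a.2, q, ⟨q.2, h⟩, rfl, rfl, rfl⟩
  · have hstart : e q = L.toDFA.start ↔
        leftEq mem (shortWords n (lengthBound Q)) [] (R.getD q []) = true := by
      rw [hu, show ([] : List ℕ) = wordVal ([] : List (Fin n)) from rfl, leftEq_iff hmem hQ,
        ← Subtype.coe_inj, Language.start_toDFA, he', Language.leftQuotient_nil, eq_comm]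
    refine Iff.trans ?_ hstart.symm
    change (q : ℕ) ∈ List.filter _ _ ↔ _
    rw [List.mem_filter, List.mem_range]
    exact ⟨fun h => h.2, fun h => ⟨q.2, h⟩⟩
  · have haccept : e q ∈ L.toDFA.accept ↔ mem (R.getD q []) = true := by
      rw [hu, hmem, Language.mem_accept_toDFA, he', Language.mem_leftQuotient, List.append_nil]
    refine Iff.trans ?_ haccept.symm
    change (q : ℕ) ∈ List.filter _ _ ↔ _
    rw [List.mem_filter, List.mem_range]
    exact ⟨fun h => h.2, fun h => ⟨q.2, h⟩⟩

theorem isMultiplicationTable_syntacticTable (hmem : IsMembershipTest mem L)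
    (hQ : QuotientBound L Q) :
    IsMultiplicationTable (syntacticTable n (lengthBound Q) mem) (SyntacticMonoid L) := by
  obtain ⟨R, hR⟩ : ∃ R, R = representatives (contextEq mem (shortWords n (lengthBound Q)))
    (shortWords n (lengthBound Q)) := ⟨_, rfl⟩
  obtain ⟨e, u, hu, he⟩ := exists_equiv_of_representatives
    (fun u => ((FreeMonoid.ofList u : FreeMonoid (Fin n)) : SyntacticMonoid L))
    (N := lengthBound Q) (contextEq_iff hmem hQ)
    (fun w => by
      obtain ⟨u, h, h'⟩ := hQ.exists_quotientAction_eq w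
      exact ⟨u, h, (coe_eq_coe_iff L _ _).2 ((quotientAction_eq_iff L _ _).1 h')⟩)
    (exists_coe_eq L) hR
  have hget : ∀ i (h : i < R.length), R[i] = wordVal (u ⟨i, h⟩) := by
    intro i h
    rw [← hu, List.getD_eq_getElem _ _ h]
  have ht : syntacticTable n (lengthBound Q) mem =
      classTable mem (shortWords n (lengthBound Q)) R := by rw [hR]; rfl
  rw [ht]
  have hlen : (classTable mem (shortWords n (lengthBound Q)) R).length = R.length := by
    simp [classTable]
  refine ⟨(finCongr hlen).trans e, fun i => ?_⟩
  have hi : (i : ℕ) < R.length := hlen ▸ i.2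
  have hrow : (classTable mem (shortWords n (lengthBound Q)) R).get i = R.map fun v =>
      R.findIdx fun r => contextEq mem (shortWords n (lengthBound Q)) r (R[(i : ℕ)] ++ v) := by
    exact List.getElem_map _
  rw [hrow]
  apply List.ext_getElem
  · simp [hlen]
  · intro j h1 h2
    have hj : j < R.length := by simpa [hlen] using h2
    rw [List.getElem_map, List.getElem_ofFn]
    -- the index found in the list is that of the unique representative of the product
    obtain ⟨k, hk⟩ := e.surjective (e ⟨i, hi⟩ * e ⟨j, hj⟩)
    have hrhs : ((((finCongr hlen).trans e).symm
        (((finCongr hlen).trans e) i * ((finCongr hlen).trans e) ⟨j, by rw [hlen]; exact hj⟩) :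
        Fin _) : ℕ) = k := by
      change ((e.symm (e ⟨i, hi⟩ * e ⟨j, hj⟩) : Fin _) : ℕ) = k
      rw [← hk, e.symm_apply_apply]
    refine Eq.trans ?_ hrhs.symm
    have htest : ∀ l (hl : l < R.length), contextEq mem (shortWords n (lengthBound Q)) R[l]
        (R[(i : ℕ)] ++ R[j]) = true ↔ (⟨l, hl⟩ : Fin R.length) = k := by
      intro l hl
      rw [hget, hget, hget, ← wordVal_append, contextEq_iff hmem hQ, ← coe_mul_coe, ← he, ← he,
        ← he, ← hk, e.injective.eq_iff]
    rw [List.findIdx_eq k.2]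
    refine ⟨(htest k k.2).2 rfl, fun l hl => ?_⟩
    rw [Bool.eq_false_iff, Ne, htest l (hl.trans k.2)]
    intro h
    exact hl.ne (congrArg Fin.val h)

end Correctness

/-! ### The test for aperiodicity -/

/-- The product of two indices in a multiplication table. -/
def tableMul (t : List (List ℕ)) (i j : ℕ) : ℕ := (t.getD i []).getD j 0

/-- The index of the power with exponent `|M| - 1`; for `|M| = 1` it is that of exponent one, which
makes no difference. -/
def tablePow (t : List (List ℕ)) (i : ℕ) : ℕ :=
  Nat.rec i (fun _ r => tableMul t r i) (t.length - 2)

/-- The test whether `m ^ (|M| - 1) = m ^ |M|` for all `m`. -/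
def aperiodicTest (t : List (List ℕ)) : Bool :=
  (List.range t.length).all fun i => tableMul t (tablePow t i) i == tablePow t i

theorem aperiodicTest_iff {M : Type} [Monoid M] {t : List (List ℕ)}
    (ht : IsMultiplicationTable t M) :
    aperiodicTest t = true ↔ ∀ m : M, m ^ (Nat.card M - 1) = m ^ Nat.card M := by
  obtain ⟨e, he⟩ := ht
  have hcard : Nat.card M = t.length := by rw [← Nat.card_congr e, Nat.card_fin]
  have hmul : ∀ i j : Fin t.length, tableMul t i j = (e.symm (e i * e j) : ℕ) := by
    intro i j
    have h := he i
    rw [List.get_eq_getElem] at h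
    rw [tableMul, List.getD_eq_getElem _ _ i.2, h, List.getD_eq_getElem _ _ (by simp)]
    simp
  have hpow : ∀ (i : Fin t.length) (k : ℕ),
      (Nat.rec (i : ℕ) (fun _ r => tableMul t r i) k : ℕ) = (e.symm (e i ^ (k + 1)) : ℕ) := by
    intro i k
    induction k with
    | zero => simp
    | succ k ih =>
      change tableMul t (Nat.rec (i : ℕ) (fun _ r => tableMul t r i) k : ℕ) i = _
      rw [ih, hmul, e.apply_symm_apply, ← pow_succ]
  have htest : ∀ i : Fin t.length, (tableMul t (tablePow t i) i == tablePow t i) = true ↔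
      e i ^ (Nat.card M - 1) = e i ^ Nat.card M := by
    intro i
    rw [beq_iff_eq, tablePow, hpow, hmul, e.apply_symm_apply, ← pow_succ, hcard, ← Fin.ext_iff,
      e.symm.injective.eq_iff, eq_comm]
    by_cases h2 : 2 ≤ t.length
    · rw [show t.length - 2 + 1 = t.length - 1 by omega,
        show t.length - 1 + 1 = t.length by omega]
    · have hpos : 0 < t.length := i.pos
      have := Finite.of_equiv _ e
      have : Subsingleton M := Finite.card_le_one_iff_subsingleton.1 (by omega)
      exact iff_of_true (Subsingleton.elim _ _) (Subsingleton.elim _ _)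
  rw [aperiodicTest, List.all_eq_true]
  constructor
  · intro h m
    obtain ⟨i, rfl⟩ := e.surjective m
    exact (htest i).1 (h i (List.mem_range.2 i.2))
  · intro h i hi
    exact (htest ⟨i, List.mem_range.1 hi⟩).2 (h _)

end WordFO

/-! ### Membership in the language of an automaton -/

namespace WordFO

/-- The list of states of the automaton that can be reached by reading a letter from a state in
`S`. -/
def nfaStep (d : AutomatonData) (S : List ℕ) (a : ℕ) : List ℕ :=
  (d.2.1.filter fun t => (S.any fun s => s == t.1) && (t.2.1 == a && decide (t.2.2 < d.1))).map
    fun t => t.2.2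

/-- The membership test for an automaton, by simulation of the set of reachable states. -/
def nfaMem (d : AutomatonData) (w : List ℕ) : Bool :=
  (w.foldl (nfaStep d) (d.2.2.1.filter fun q => decide (q < d.1))).any fun q =>
    d.2.2.2.any fun r => r == q

theorem mem_foldl_nfaStep {n : ℕ} (d : AutomatonData) (w : List (Fin n)) (q : ℕ) :
    q ∈ (wordVal w).foldl (nfaStep d) (d.2.2.1.filter fun q => decide (q < d.1)) ↔
      ∃ h : q < d.1, (⟨q, h⟩ : Fin d.1) ∈ (d.toNFA n).evalFrom (d.toNFA n).start w := by
  induction w using List.reverseRecOn generalizing q with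
  | nil =>
    simp [wordVal, AutomatonData.toNFA, and_comm]
  | append_singleton w a ih =>
    rw [NFA.evalFrom_append, NFA.evalFrom_singleton, wordVal_append, List.foldl_append,
      show wordVal [a] = [(a : ℕ)] from rfl, List.foldl_cons, List.foldl_nil, nfaStep]
    simp only [List.mem_map, List.mem_filter, Bool.and_eq_true, List.any_eq_true, beq_iff_eq,
      decide_eq_true_eq, ih, NFA.mem_stepSet]
    constructor
    · rintro ⟨⟨p, b, q'⟩, ⟨ht, ⟨p', ⟨hp', hmem⟩, rfl⟩, rfl, hq⟩, rfl⟩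
      exact ⟨hq, ⟨p', hp'⟩, hmem, ht⟩
    · rintro ⟨hq, ⟨p, hp⟩, hmem, ht⟩
      exact ⟨(p, a, q), ⟨ht, ⟨p, ⟨hp, hmem⟩, rfl⟩, rfl, hq⟩, rfl⟩

theorem isMembershipTest_nfaMem (n : ℕ) (d : AutomatonData) :
    IsMembershipTest (nfaMem d) (d.toNFA n).accepts := by
  intro w
  rw [nfaMem, List.any_eq_true, NFA.mem_accepts]
  simp only [mem_foldl_nfaStep, List.any_eq_true, beq_iff_eq]
  constructor
  · rintro ⟨q, ⟨hq, h⟩, r, hr, rfl⟩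
    exact ⟨⟨r, hq⟩, hr, h⟩
  · rintro ⟨⟨q, hq⟩, hr, h⟩
    exact ⟨q, ⟨hq, h⟩, q, hr, rfl⟩

/-- Up to the isomorphism `e`, the only state reached by reading `w` is the one of the deterministic
minimal automaton. -/
theorem mem_evalFrom_start_iff_eval_toDFA (n : ℕ) (d : AutomatonData) (L : Language (Fin n))
    (e : Fin d.1 ≃ Set.range L.leftQuotient)
    (hstep : ∀ p a q, q ∈ (d.toNFA n).step p a ↔ L.toDFA.step (e p) a = e q)
    (hstart : ∀ q, q ∈ (d.toNFA n).start ↔ e q = L.toDFA.start) (w : List (Fin n)) (q : Fin d.1) :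
    q ∈ (d.toNFA n).evalFrom (d.toNFA n).start w ↔ e q = L.toDFA.eval w := by
  induction w using List.reverseRecOn generalizing q with
  | nil => exact hstart q
  | append_singleton w a ih =>
    rw [NFA.evalFrom_append, NFA.evalFrom_singleton, NFA.mem_stepSet,
      DFA.eval_append_singleton]
    constructor
    · rintro ⟨p, hp, hq⟩
      rw [← (hstep p a q).1 hq, (ih p).1 hp]
    · intro h
      refine ⟨e.symm (L.toDFA.eval w), (ih _).2 (e.apply_symm_apply _), (hstep _ _ _).2 ?_⟩
      rw [e.apply_symm_apply, h]

/-- A description of the minimal automaton of `L` accepts `L`. -/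
theorem accepts_eq_of_isMinimalAutomaton {n : ℕ} {d : AutomatonData} {L : Language (Fin n)}
    (h : IsMinimalAutomaton n d L) : (d.toNFA n).accepts = L := by
  obtain ⟨e, hstep, hstart, haccept⟩ := h
  conv_rhs => rw [← L.accepts_toDFA]
  ext w
  rw [NFA.mem_accepts, DFA.mem_accepts]
  simp only [mem_evalFrom_start_iff_eval_toDFA n d L e hstep hstart]
  constructor
  · rintro ⟨q, hq, h⟩
    rw [← h]
    exact (haccept q).1 hq
  · intro h
    exact ⟨e.symm (L.toDFA.eval w), (haccept _).2 (by rwa [e.apply_symm_apply]),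
      e.apply_symm_apply _⟩

/-! ### Evaluation of rational expressions in postfix notation -/

/-- An interpretation of the letters and of the operations of rational expressions in `σ`. -/
structure ExprAlgebra (σ : Type) where
  /-- the value of `∅` -/
  zero : σ
  /-- the value of `ε` -/
  epsilon : σ
  /-- the value of a letter -/
  char : ℕ → σ
  /-- the interpretation of the union -/
  plus : σ → σ → σ
  /-- the interpretation of the product -/
  comp : σ → σ → σ
  /-- the interpretation of the star -/
  star : σ → σ

namespace ExprAlgebra

variable {σ : Type} (I : ExprAlgebra σ)

/-- The value of an expression. -/
def eval {n : ℕ} : RegularExpression (Fin n) → σ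
  | .zero => I.zero
  | .epsilon => I.epsilon
  | .char a => I.char a
  | .plus e f => I.plus (eval e) (eval f)
  | .comp e f => I.comp (eval e) (eval f)
  | .star e => I.star (eval e)

/-- One step of the evaluation of a postfix string over the alphabet of size `n`, with a stack of
values. -/
def step (n : ℕ) (st : List σ) (c : ℕ) : List σ :=
  if c = 0 then I.zero :: st
  else if c = 1 then I.epsilon :: st
  else if c = 2 then
    if 2 ≤ st.length then I.plus (st.getD 1 I.zero) (st.getD 0 I.zero) :: st.tail.tail else st
  else if c = 3 then
    if 2 ≤ st.length then I.comp (st.getD 1 I.zero) (st.getD 0 I.zero) :: st.tail.tail else st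
  else if c = 4 then
    if 1 ≤ st.length then I.star (st.getD 0 I.zero) :: st.tail else st
  else if c - 5 < n then I.char (c - 5) :: st else st

/-- The stack of values after the evaluation of a postfix string. -/
def run (n : ℕ) (s : List ℕ) : List σ := s.foldl (I.step n) []

theorem step_map_eval {n : ℕ} (st : List (RegularExpression (Fin n))) (c : ℕ) :
    I.step n (st.map I.eval) c = (RegularExpression.readToken st c).map I.eval := by
  match c, st with
  | 0, st => rfl
  | 1, st => rfl
  | 2, [] => rfl
  | 2, [e] => rfl
  | 2, f :: e :: st => simp [step, RegularExpression.readToken, eval]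
  | 3, [] => rfl
  | 3, [e] => rfl
  | 3, f :: e :: st => simp [step, RegularExpression.readToken, eval]
  | 4, [] => rfl
  | 4, e :: st => simp [step, RegularExpression.readToken, eval]
  | a + 5, st =>
    by_cases h : a < n
    · simp [step, RegularExpression.readToken, h, eval]
    · simp [step, RegularExpression.readToken, h]

theorem run_eq {n : ℕ} (s : List ℕ) : I.run n s =
    (s.foldl RegularExpression.readToken ([] : List (RegularExpression (Fin n)))).map I.eval := by
  have : ∀ st : List (RegularExpression (Fin n)), s.foldl (I.step n) (st.map I.eval) =
      (s.foldl RegularExpression.readToken st).map I.eval := by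
    induction s with
    | nil => exact fun _ => rfl
    | cons c s ih =>
      intro st
      rw [List.foldl_cons, List.foldl_cons, step_map_eval, ih]
  exact this []

/-- The value of the expression denoted by a postfix string. -/
def evalString (n : ℕ) (s : List ℕ) : σ := (I.run n s).getD 0 I.zero

theorem evalString_postfixString {n : ℕ} (e : RegularExpression (Fin n)) :
    I.evalString n e.postfixString = I.eval e := by
  rw [evalString, run_eq, RegularExpression.foldl_readToken]
  rfl

end ExprAlgebra

/-- The interpretation of expressions by their postfix notation. -/
def postfixAlgebra : ExprAlgebra (List ℕ) where
  zero := [0]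
  epsilon := [1]
  char a := [a + 5]
  plus x y := x ++ y ++ [2]
  comp x y := x ++ y ++ [3]
  star x := x ++ [4]

theorem eval_postfixAlgebra {n : ℕ} (e : RegularExpression (Fin n)) :
    postfixAlgebra.eval e = e.postfixString := by
  induction e with
  | zero => rfl
  | epsilon => rfl
  | char a => rfl
  | plus e f he hf => rw [ExprAlgebra.eval, he, hf]; rfl
  | comp e f he hf => rw [ExprAlgebra.eval, he, hf]; rfl
  | star e he => rw [ExprAlgebra.eval, he]; rfl

/-- A string is the postfix notation of an expression iff reading it and writing down the result
gives it back. -/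
theorem exists_postfixString_eq_iff {n : ℕ} {s : List ℕ} :
    (∃ e : RegularExpression (Fin n), s = e.postfixString) ↔ postfixAlgebra.run n s = [s] := by
  rw [ExprAlgebra.run_eq]
  constructor
  · rintro ⟨e, rfl⟩
    rw [RegularExpression.foldl_readToken]
    simp [eval_postfixAlgebra]
  · intro h
    obtain ⟨e, -, he⟩ := List.map_eq_singleton_iff.1 h
    exact ⟨e, by rw [← he, eval_postfixAlgebra]⟩

/-- The interpretation of expressions by bounds for the number of left quotients. -/
def boundAlgebra : ExprAlgebra ℕ where
  zero := 1
  epsilon := 2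
  char _ := 3
  plus x y := x * y
  comp x y := x * 2 ^ y
  star x := 2 ^ x + 1

theorem quotientBound_eval {n : ℕ} (e : RegularExpression (Fin n)) :
    QuotientBound e.matches' (boundAlgebra.eval e) := by
  induction e with
  | zero => exact quotientBound_zero
  | epsilon => exact quotientBound_one
  | char a => exact quotientBound_char a
  | plus e f he hf => exact he.add hf
  | comp e f he hf => exact he.mul hf
  | star e he => exact he.kstar

/-- The concatenations of a word from `X` and a word from `Y`. -/
def concatLists (X Y : List (List ℕ)) : List (List ℕ) := X.flatMap fun u => Y.map fun v => u ++ v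

theorem mem_concatLists {X Y : List (List ℕ)} {w : List ℕ} :
    w ∈ concatLists X Y ↔ ∃ u ∈ X, ∃ v ∈ Y, u ++ v = w := by
  simp [concatLists]

/-- The interpretation of expressions by finite lists of words that contain all words of length at
most `l` of the language. -/
def wordsAlgebra (l : ℕ) : ExprAlgebra (List (List ℕ)) where
  zero := []
  epsilon := [[]]
  char a := [[a]]
  plus X Y := X ++ Y
  comp X Y := concatLists X Y
  star X := Nat.rec [[]] (fun _ Y => [] :: concatLists X Y) l

theorem wordVal_injective {n : ℕ} : Function.Injective (wordVal (n := n)) :=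
  List.map_injective_iff.2 Fin.val_injective

theorem wordVal_mem_concatLists {n l : ℕ} {X Y : List (List ℕ)} {L K : Language (Fin n)}
    {w : List (Fin n)} (hw : w.length ≤ l)
    (hX : ∀ u : List (Fin n), u.length ≤ l → (wordVal u ∈ X ↔ u ∈ L))
    (hY : ∀ v : List (Fin n), v.length ≤ l → (wordVal v ∈ Y ↔ v ∈ K)) :
    wordVal w ∈ concatLists X Y ↔ w ∈ L * K := by
  rw [mem_concatLists, Language.mem_mul]
  constructor
  · rintro ⟨u', hu, v', hv, h⟩
    obtain ⟨u, v, rfl, rfl, rfl⟩ := List.map_eq_append_iff.1 h.symm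
    rw [List.length_append] at hw
    exact ⟨u, (hX u (by omega)).1 hu, v, (hY v (by omega)).1 hv, rfl⟩
  · rintro ⟨u, hu, v, hv, rfl⟩
    rw [List.length_append] at hw
    exact ⟨_, (hX u (by omega)).2 hu, _, (hY v (by omega)).2 hv,
      (wordVal_append u v).symm⟩

/-- Among words of length at most `l`, the `k`-th iterate consists of the products of at most `k`
words of `L`. -/
theorem wordVal_mem_iterate {n l : ℕ} {X : List (List ℕ)} {L : Language (Fin n)}
    (hX : ∀ u : List (Fin n), u.length ≤ l → (wordVal u ∈ X ↔ u ∈ L)) (k : ℕ)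
    (w : List (Fin n)) (hw : w.length ≤ l) :
    wordVal w ∈ (Nat.rec [[]] (fun _ Y => [] :: concatLists X Y) k : List (List ℕ)) ↔
      ∃ S : List (List (Fin n)), S.length ≤ k ∧ w = S.flatten ∧ ∀ y ∈ S, y ∈ L := by
  induction k generalizing w with
  | zero =>
    constructor
    · intro h
      exact ⟨[], le_rfl, by simpa [wordVal] using h, by simp⟩
    · rintro ⟨S, hS, rfl, -⟩
      obtain rfl : S = [] := List.length_eq_zero_iff.1 (Nat.le_zero.1 hS)
      simp [wordVal]
  | succ k ih =>
    change wordVal w ∈ [] :: concatLists X _ ↔ _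
    obtain ⟨K, hK⟩ : ∃ K : Language (Fin n), ∀ v, v ∈ K ↔ ∃ S : List (List (Fin n)),
      S.length ≤ k ∧ v = S.flatten ∧ ∀ y ∈ S, y ∈ L := ⟨{v | _}, fun _ => Iff.rfl⟩
    rw [List.mem_cons, wordVal_mem_concatLists (K := K) hw hX
      (fun v hv => (ih v hv).trans (hK v).symm), Language.mem_mul]
    simp only [hK]
    constructor
    · rintro (h | ⟨u, hu, v, ⟨S, hS, rfl, hL⟩, rfl⟩)
      · exact ⟨[], Nat.zero_le _, by simpa [wordVal] using h, by simp⟩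
      · exact ⟨u :: S, Nat.succ_le_succ hS, rfl, List.forall_mem_cons.2 ⟨hu, hL⟩⟩
    · rintro ⟨S, hS, rfl, hL⟩
      cases S with
      | nil => exact Or.inl rfl
      | cons u S =>
        exact Or.inr ⟨u, hL u List.mem_cons_self, S.flatten, ⟨S, Nat.le_of_succ_le_succ hS, rfl,
          fun y hy => hL y (List.mem_cons_of_mem _ hy)⟩, rfl⟩

theorem wordVal_mem_eval_wordsAlgebra {n l : ℕ} (e : RegularExpression (Fin n))
    (w : List (Fin n)) (hw : w.length ≤ l) :
    wordVal w ∈ (wordsAlgebra l).eval e ↔ w ∈ e.matches' := by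
  induction e generalizing w with
  | zero =>
    exact iff_of_false (List.not_mem_nil) (Language.notMem_zero w)
  | epsilon =>
    change wordVal w ∈ [[]] ↔ w ∈ (1 : Language (Fin n))
    simp [wordVal, Language.mem_one]
  | char a =>
    change wordVal w ∈ [wordVal [a]] ↔ w = [a]
    rw [List.mem_singleton, wordVal_injective.eq_iff]
  | plus e f he hf =>
    change wordVal w ∈ _ ++ _ ↔ w ∈ e.matches' + f.matches'
    rw [List.mem_append, Language.mem_add, he w hw, hf w hw]
  | comp e f he hf =>
    exact wordVal_mem_concatLists hw he hf
  | star e he =>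
    change wordVal w ∈ (Nat.rec [[]] (fun _ Y => [] :: concatLists _ Y) l : List (List ℕ)) ↔
      w ∈ KStar.kstar e.matches'
    rw [wordVal_mem_iterate he l w hw, Language.kstar_def_nonempty]
    constructor
    · rintro ⟨S, -, rfl, hS⟩
      rw [← Language.kstar_def_nonempty]
      exact Language.join_mem_kstar hS
    · rintro ⟨S, rfl, hS⟩
      refine ⟨S, ?_, rfl, fun y hy => (hS y hy).1⟩
      -- the factors are nonempty, so there are at most `l` of them
      refine le_trans ?_ hw
      clear hw
      induction S with
      | nil => simp
      | cons u S ih =>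
        have hu := List.length_pos_iff.2 (hS u List.mem_cons_self).2
        have := ih fun y hy => hS y (List.mem_cons_of_mem _ hy)
        rw [List.length_cons, List.flatten_cons, List.length_append]
        omega

/-- The membership test for a rational expression in postfix notation. -/
def exprMem (n : ℕ) (s : List ℕ) (w : List ℕ) : Bool :=
  ((wordsAlgebra w.length).evalString n s).any fun v => decide (v = w)

theorem isMembershipTest_exprMem {n : ℕ} (e : RegularExpression (Fin n)) :
    IsMembershipTest (exprMem n e.postfixString) e.matches' := by
  intro w
  rw [exprMem, ExprAlgebra.evalString_postfixString, List.any_eq_true]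
  rw [← wordVal_mem_eval_wordsAlgebra (l := (wordVal w).length) e w (by simp [wordVal])]
  simp

end WordFO

/-! ### Primitive recursiveness of the algorithms -/

namespace WordFO

section Lists

variable {α β : Type} [Primcodable α] [Primcodable β]

theorem primrec_any {f : α → List β} {p : α → β → Bool} (hf : Primrec f) (hp : Primrec₂ p) :
    Primrec fun a => (f a).any (p a) := by
  refine (Primrec.list_foldr hf (Primrec.const false) (h := fun a x => p a x.1 || x.2)
    (Primrec.or.comp₂ (hp.comp₂ Primrec₂.left (Primrec.fst.comp₂ Primrec₂.right))
      (Primrec.snd.comp₂ Primrec₂.right))).of_eq fun a => ?_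
  induction f a with
  | nil => rfl
  | cons b l ih => rw [List.foldr_cons, ih, List.any_cons]

theorem primrec_all {f : α → List β} {p : α → β → Bool} (hf : Primrec f) (hp : Primrec₂ p) :
    Primrec fun a => (f a).all (p a) :=
  (Primrec.not.comp (primrec_any hf (Primrec.not.comp₂ hp))).of_eq fun a => by
    rw [List.all_eq_not_any_not]

theorem primrec_filter {f : α → List β} {p : α → β → Bool} (hf : Primrec f) (hp : Primrec₂ p) :
    Primrec fun a => (f a).filter (p a) := by
  refine (Primrec.list_foldr hf (Primrec.const []) (h := fun a x => bif p a x.1 then x.1 :: x.2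
    else x.2) (Primrec.cond (hp.comp₂ Primrec₂.left (Primrec.fst.comp₂ Primrec₂.right))
      (Primrec.list_cons.comp₂ (Primrec.fst.comp₂ Primrec₂.right)
        (Primrec.snd.comp₂ Primrec₂.right))
      (Primrec.snd.comp₂ Primrec₂.right))).of_eq fun a => ?_
  induction f a with
  | nil => rfl
  | cons b l ih =>
    rw [List.foldr_cons, ih, List.filter_cons]
    cases p a b <;> rfl

theorem primrec_representatives {f : α → List β} {E : α → β → β → Bool} (hf : Primrec f)
    (hE : Primrec₂ fun (a : α) (x : β × β) => E a x.1 x.2) :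
    Primrec fun a => representatives (E a) (f a) := by
  have hany : Primrec fun p : α × β × List β => p.2.2.any fun r => E p.1 r p.2.1 :=
    primrec_any (Primrec.snd.comp Primrec.snd)
      (hE.comp₂ (Primrec.fst.comp₂ Primrec₂.left)
        (Primrec₂.pair.comp₂ Primrec₂.right
          ((Primrec.fst.comp Primrec.snd).comp₂ Primrec₂.left)))
  refine (Primrec.list_foldr hf (Primrec.const []) (h := fun a x =>
    bif x.2.any fun r => E a r x.1 then x.2 else x.1 :: x.2) (Primrec.cond hany
      (Primrec.snd.comp₂ Primrec₂.right)
      (Primrec.list_cons.comp₂ (Primrec.fst.comp₂ Primrec₂.right)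
        (Primrec.snd.comp₂ Primrec₂.right)))).of_eq fun a => ?_
  rw [representatives]
  congr 1
  funext w R
  exact Bool.cond_eq_ite ..

end Lists

theorem primrec_shortWords : Primrec₂ shortWords := by
  have h : Primrec₂ fun (p : ℕ × ℕ) (x : ℕ × List (List ℕ)) =>
      [] :: x.2.flatMap fun w => (List.range p.1).map fun a => a :: w := by
    refine Primrec.list_cons.comp₂ (Primrec₂.const []) ?_
    refine Primrec.list_flatMap (Primrec.snd.comp Primrec.snd) ?_
    refine Primrec.list_map (Primrec.list_range.comp
      (Primrec.fst.comp (Primrec.fst.comp Primrec.fst))) ?_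
    exact Primrec.list_cons.comp₂ Primrec₂.right (Primrec.snd.comp₂ Primrec₂.left)
  exact Primrec.nat_rec' Primrec.snd (Primrec.const [[]]) h

section Algorithms

variable {α : Type} [Primcodable α] {mem : α → List ℕ → Bool} {W R : α → List (List ℕ)}
  {n N : α → ℕ}

theorem primrec_leftEq (hmem : Primrec₂ mem) (hW : Primrec W) :
    Primrec₂ fun (a : α) (x : List ℕ × List ℕ) => leftEq (mem a) (W a) x.1 x.2 := by
  refine primrec_all (hW.comp Primrec.fst) ?_
  refine Primrec.beq.comp₂ (hmem.comp₂ (Primrec.fst.comp₂ Primrec₂.left)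
    (Primrec.list_append.comp₂ ?_ Primrec₂.right)) (hmem.comp₂ (Primrec.fst.comp₂ Primrec₂.left)
    (Primrec.list_append.comp₂ ?_ Primrec₂.right))
  · exact (Primrec.fst.comp Primrec.snd).comp₂ Primrec₂.left
  · exact (Primrec.snd.comp Primrec.snd).comp₂ Primrec₂.left

theorem primrec_contextEq (hmem : Primrec₂ mem) (hW : Primrec W) :
    Primrec₂ fun (a : α) (x : List ℕ × List ℕ) => contextEq (mem a) (W a) x.1 x.2 := by
  refine primrec_all (hW.comp Primrec.fst) ?_
  refine primrec_all (hW.comp (Primrec.fst.comp Primrec.fst)) ?_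
  have ha : Primrec₂ fun (y : (α × List ℕ × List ℕ) × List ℕ) (_z : List ℕ) => y.1.1 :=
    (Primrec.fst.comp Primrec.fst).comp₂ Primrec₂.left
  have hx : Primrec₂ fun (y : (α × List ℕ × List ℕ) × List ℕ) (_z : List ℕ) => y.2 :=
    Primrec.snd.comp₂ Primrec₂.left
  refine Primrec.beq.comp₂
    (hmem.comp₂ ha (Primrec.list_append.comp₂ hx (Primrec.list_append.comp₂ ?_ Primrec₂.right)))
    (hmem.comp₂ ha (Primrec.list_append.comp₂ hx (Primrec.list_append.comp₂ ?_ Primrec₂.right)))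
  · exact (Primrec.fst.comp (Primrec.snd.comp Primrec.fst)).comp₂ Primrec₂.left
  · exact (Primrec.snd.comp (Primrec.snd.comp Primrec.fst)).comp₂ Primrec₂.left

theorem primrec_quotientAutomaton (hmem : Primrec₂ mem) (hW : Primrec W) (hR : Primrec R)
    (hn : Primrec n) : Primrec fun a => quotientAutomaton (n a) (mem a) (W a) (R a) := by
  have hrange : Primrec fun a => List.range (R a).length :=
    Primrec.list_range.comp (Primrec.list_length.comp hR)
  have hget : Primrec₂ fun (a : α) (q : ℕ) => (R a).getD q [] :=
    (Primrec.list_getD []).comp₂ (hR.comp₂ Primrec₂.left) Primrec₂.right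
  have hleft := primrec_leftEq hmem hW
  refine Primrec.pair (Primrec.list_length.comp hR) (Primrec.pair ?_ (Primrec.pair ?_ ?_))
  · refine Primrec.list_flatMap hrange ?_
    refine Primrec.list_flatMap (Primrec.list_range.comp (hn.comp Primrec.fst)) ?_
    refine Primrec.list_map (primrec_filter (hrange.comp (Primrec.fst.comp Primrec.fst)) ?_) ?_
    · refine hleft.comp₂ ((Primrec.fst.comp Primrec.fst).comp₂ Primrec₂.left)
        (Primrec₂.pair.comp₂ (Primrec.list_append.comp₂ ?_ ?_) ?_)
      · exact (hget.comp (Primrec.fst.comp Primrec.fst) (Primrec.snd.comp Primrec.fst)).comp₂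
          Primrec₂.left
      · exact Primrec.list_cons.comp₂ (Primrec.snd.comp₂ Primrec₂.left) (Primrec₂.const [])
      · exact hget.comp₂ ((Primrec.fst.comp Primrec.fst).comp₂ Primrec₂.left) Primrec₂.right
    · exact Primrec₂.pair.comp₂ ((Primrec.snd.comp Primrec.fst).comp₂ Primrec₂.left)
        (Primrec₂.pair.comp₂ (Primrec.snd.comp₂ Primrec₂.left) Primrec₂.right)
  · exact primrec_filter hrange (hleft.comp₂ Primrec₂.left
      (Primrec₂.pair.comp₂ (Primrec₂.const []) hget))
  · exact primrec_filter hrange (hmem.comp₂ Primrec₂.left hget)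

theorem primrec_minimalAutomaton (hmem : Primrec₂ mem) (hn : Primrec n) (hN : Primrec N) :
    Primrec fun a => minimalAutomaton (n a) (N a) (mem a) := by
  have hW := primrec_shortWords.comp hn hN
  exact primrec_quotientAutomaton hmem hW
    (primrec_representatives hW (primrec_leftEq hmem hW)) hn

theorem primrec_classTable (hmem : Primrec₂ mem) (hW : Primrec W) (hR : Primrec R) :
    Primrec fun a => classTable (mem a) (W a) (R a) := by
  have hE : Primrec₂ fun (p : (α × List ℕ) × List ℕ) (r : List ℕ) =>
      contextEq (mem p.1.1) (W p.1.1) r (p.1.2 ++ p.2) :=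
    (primrec_contextEq hmem hW).comp₂ ((Primrec.fst.comp Primrec.fst).comp₂ Primrec₂.left)
      (Primrec₂.pair.comp₂ Primrec₂.right ((Primrec.list_append.comp
        (Primrec.snd.comp Primrec.fst) Primrec.snd).comp₂ Primrec₂.left))
  have hindex : Primrec₂ fun (q : α × List ℕ) (v : List ℕ) =>
      (R q.1).findIdx fun r => contextEq (mem q.1) (W q.1) r (q.2 ++ v) :=
    Primrec.list_findIdx (hR.comp (Primrec.fst.comp Primrec.fst)) hE
  have hrow : Primrec₂ fun (a : α) (u : List ℕ) => (R a).map fun v =>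
      (R a).findIdx fun r => contextEq (mem a) (W a) r (u ++ v) :=
    Primrec.list_map (hR.comp Primrec.fst) hindex
  exact Primrec.list_map hR hrow

theorem primrec_syntacticTable (hmem : Primrec₂ mem) (hn : Primrec n) (hN : Primrec N) :
    Primrec fun a => syntacticTable (n a) (N a) (mem a) := by
  have hW := primrec_shortWords.comp hn hN
  exact primrec_classTable hmem hW (primrec_representatives hW (primrec_contextEq hmem hW))

end Algorithms

theorem primrec_pow : Primrec₂ ((· ^ ·) : ℕ → ℕ → ℕ) :=
  Primrec₂.unpaired'.1 Nat.Primrec.pow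

theorem primrec_lengthBound : Primrec lengthBound :=
  primrec_pow.comp (Primrec.const 2) (Primrec.nat_mul.comp Primrec.id Primrec.id)

theorem primrec_tableMul :
    Primrec₂ fun (t : List (List ℕ)) (x : ℕ × ℕ) => tableMul t x.1 x.2 :=
  (Primrec.list_getD 0).comp₂ ((Primrec.list_getD []).comp₂ Primrec₂.left
    (Primrec.fst.comp₂ Primrec₂.right)) (Primrec.snd.comp₂ Primrec₂.right)

theorem primrec_tablePow : Primrec₂ tablePow := by
  have h : Primrec₂ fun (p : List (List ℕ) × ℕ) (x : ℕ × ℕ) => tableMul p.1 x.2 p.2 :=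
    primrec_tableMul.comp₂ (Primrec.fst.comp₂ Primrec₂.left)
      (Primrec₂.pair.comp₂ (Primrec.snd.comp₂ Primrec₂.right) (Primrec.snd.comp₂ Primrec₂.left))
  exact Primrec.nat_rec' (Primrec.nat_sub.comp (Primrec.list_length.comp Primrec.fst)
    (Primrec.const 2)) Primrec.snd h

theorem primrec_aperiodicTest : Primrec aperiodicTest := by
  refine primrec_all (Primrec.list_range.comp Primrec.list_length) ?_
  exact Primrec.beq.comp₂ (primrec_tableMul.comp₂ Primrec₂.left
    (Primrec₂.pair.comp₂ primrec_tablePow Primrec₂.right)) primrec_tablePow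

theorem primrec_nfaStep :
    Primrec₂ fun (d : AutomatonData) (x : List ℕ × ℕ) => nfaStep d x.1 x.2 := by
  refine Primrec.list_map (primrec_filter ((Primrec.fst.comp Primrec.snd).comp Primrec.fst) ?_)
    ((Primrec.snd.comp Primrec.snd).comp₂ Primrec₂.right)
  refine Primrec.and.comp₂ ?_ (Primrec.and.comp₂ ?_ ?_)
  · exact primrec_any (Primrec.fst.comp (Primrec.snd.comp Primrec.fst))
      (Primrec.beq.comp₂ Primrec₂.right ((Primrec.fst.comp Primrec.snd).comp₂ Primrec₂.left))
  · exact Primrec.beq.comp₂ ((Primrec.fst.comp Primrec.snd).comp₂ Primrec₂.right)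
      ((Primrec.snd.comp Primrec.snd).comp₂ Primrec₂.left)
  · exact Primrec.nat_lt.decide.comp₂ ((Primrec.snd.comp Primrec.snd).comp₂ Primrec₂.right)
      ((Primrec.fst.comp Primrec.fst).comp₂ Primrec₂.left)

theorem primrec_nfaMem : Primrec₂ nfaMem := by
  refine primrec_any (Primrec.list_foldl Primrec.snd ?_ (h := fun p x => nfaStep p.1 x.1 x.2) ?_) ?_
  · exact primrec_filter ((Primrec.fst.comp (Primrec.snd.comp Primrec.snd)).comp Primrec.fst)
      (Primrec.nat_lt.decide.comp₂ Primrec₂.right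
        ((Primrec.fst.comp Primrec.fst).comp₂ Primrec₂.left))
  · exact primrec_nfaStep.comp₂ (Primrec.fst.comp₂ Primrec₂.left) Primrec₂.right
  · exact primrec_any ((Primrec.snd.comp (Primrec.snd.comp Primrec.snd)).comp
      (Primrec.fst.comp Primrec.fst))
      (Primrec.beq.comp₂ Primrec₂.right (Primrec.snd.comp₂ Primrec₂.left))

/-- The operations of the algebras `I a` are primitive recursive, uniformly in `a`. -/
structure PrimrecAlgebra {α σ : Type} [Primcodable α] [Primcodable σ] (I : α → ExprAlgebra σ) :
    Prop where
  zero : Primrec fun a => (I a).zero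
  epsilon : Primrec fun a => (I a).epsilon
  char : Primrec₂ fun a c => (I a).char c
  plus : Primrec₂ fun a (x : σ × σ) => (I a).plus x.1 x.2
  comp : Primrec₂ fun a (x : σ × σ) => (I a).comp x.1 x.2
  star : Primrec₂ fun a x => (I a).star x

section Algebra

variable {α σ : Type} [Primcodable α] [Primcodable σ] {I : α → ExprAlgebra σ}

theorem PrimrecAlgebra.step (h : PrimrecAlgebra I) {n : α → ℕ} (hn : Primrec n) :
    Primrec₂ fun (a : α) (x : List σ × ℕ) => (I a).step (n a) x.1 x.2 := by
  have ha : Primrec fun p : α × List σ × ℕ => p.1 := Primrec.fst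
  have hst : Primrec fun p : α × List σ × ℕ => p.2.1 := Primrec.fst.comp Primrec.snd
  have hc : Primrec fun p : α × List σ × ℕ => p.2.2 := Primrec.snd.comp Primrec.snd
  have hz := h.zero.comp ha
  have hget : ∀ k : ℕ, Primrec fun p : α × List σ × ℕ => p.2.1.getD k (I p.1).zero := fun k =>
    (Primrec.option_getD.comp (Primrec.list_getElem?.comp hst (Primrec.const k)) hz).of_eq
      fun p => by rw [List.getD_eq_getElem?_getD]
  have hlen : ∀ k : ℕ, PrimrecPred fun p : α × List σ × ℕ => k ≤ p.2.1.length := fun k =>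
    Primrec.nat_le.comp (Primrec.const k) (Primrec.list_length.comp hst)
  have hceq : ∀ k : ℕ, PrimrecPred fun p : α × List σ × ℕ => p.2.2 = k := fun k =>
    Primrec.eq.comp hc (Primrec.const k)
  have hsub : Primrec fun p : α × List σ × ℕ => p.2.2 - 5 :=
    Primrec.nat_sub.comp hc (Primrec.const 5)
  refine Primrec.ite (hceq 0) (Primrec.list_cons.comp hz hst) ?_
  refine Primrec.ite (hceq 1) (Primrec.list_cons.comp (h.epsilon.comp ha) hst) ?_
  refine Primrec.ite (hceq 2) (Primrec.ite (hlen 2) (Primrec.list_cons.comp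
    (h.plus.comp ha (Primrec.pair (hget 1) (hget 0)))
    (Primrec.list_tail.comp (Primrec.list_tail.comp hst))) hst) ?_
  refine Primrec.ite (hceq 3) (Primrec.ite (hlen 2) (Primrec.list_cons.comp
    (h.comp.comp ha (Primrec.pair (hget 1) (hget 0)))
    (Primrec.list_tail.comp (Primrec.list_tail.comp hst))) hst) ?_
  refine Primrec.ite (hceq 4) (Primrec.ite (hlen 1) (Primrec.list_cons.comp
    (h.star.comp ha (hget 0)) (Primrec.list_tail.comp hst)) hst) ?_
  exact Primrec.ite (Primrec.nat_lt.comp hsub (hn.comp ha)) (Primrec.list_cons.comp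
    (h.char.comp ha hsub) hst) hst

theorem PrimrecAlgebra.run (h : PrimrecAlgebra I) {n : α → ℕ} {s : α → List ℕ} (hn : Primrec n)
    (hs : Primrec s) : Primrec fun a => (I a).run (n a) (s a) :=
  Primrec.list_foldl hs (Primrec.const []) (h.step hn)

theorem PrimrecAlgebra.evalString (h : PrimrecAlgebra I) {n : α → ℕ} {s : α → List ℕ}
    (hn : Primrec n) (hs : Primrec s) : Primrec fun a => (I a).evalString (n a) (s a) :=
  (Primrec.option_getD.comp (Primrec.list_getElem?.comp (h.run hn hs) (Primrec.const 0))
    h.zero).of_eq fun a => by rw [ExprAlgebra.evalString, List.getD_eq_getElem?_getD]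

end Algebra

theorem primrecAlgebra_postfixAlgebra :
    PrimrecAlgebra fun _ : ℕ × List ℕ => postfixAlgebra where
  zero := Primrec.const _
  epsilon := Primrec.const _
  char := Primrec.list_cons.comp₂
    (Primrec.nat_add.comp₂ Primrec₂.right (Primrec₂.const 5)) (Primrec₂.const [])
  plus := Primrec.list_append.comp₂ (Primrec.list_append.comp₂
    (Primrec.fst.comp₂ Primrec₂.right) (Primrec.snd.comp₂ Primrec₂.right)) (Primrec₂.const [2])
  comp := Primrec.list_append.comp₂ (Primrec.list_append.comp₂
    (Primrec.fst.comp₂ Primrec₂.right) (Primrec.snd.comp₂ Primrec₂.right)) (Primrec₂.const [3])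
  star := Primrec.list_append.comp₂ Primrec₂.right (Primrec₂.const [4])

theorem primrecAlgebra_boundAlgebra :
    PrimrecAlgebra fun _ : ℕ × List ℕ => boundAlgebra where
  zero := Primrec.const _
  epsilon := Primrec.const _
  char := Primrec₂.const _
  plus := Primrec.nat_mul.comp₂ (Primrec.fst.comp₂ Primrec₂.right)
    (Primrec.snd.comp₂ Primrec₂.right)
  comp := Primrec.nat_mul.comp₂ (Primrec.fst.comp₂ Primrec₂.right)
    (primrec_pow.comp₂ (Primrec₂.const 2) (Primrec.snd.comp₂ Primrec₂.right))
  star := Primrec.succ.comp₂ (primrec_pow.comp₂ (Primrec₂.const 2) Primrec₂.right)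

theorem primrec_concatLists : Primrec₂ concatLists :=
  Primrec.list_flatMap Primrec.fst (Primrec.list_map (Primrec.snd.comp Primrec.fst)
    (Primrec.list_append.comp₂ (Primrec.snd.comp₂ Primrec₂.left) Primrec₂.right))

theorem primrecAlgebra_wordsAlgebra :
    PrimrecAlgebra fun p : (ℕ × List ℕ) × List ℕ => wordsAlgebra p.2.length where
  zero := Primrec.const _
  epsilon := Primrec.const _
  char := Primrec.list_cons.comp₂ (Primrec.list_cons.comp₂ Primrec₂.right (Primrec₂.const []))
    (Primrec₂.const [])
  plus := Primrec.list_append.comp₂ (Primrec.fst.comp₂ Primrec₂.right)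
    (Primrec.snd.comp₂ Primrec₂.right)
  comp := primrec_concatLists.comp₂ (Primrec.fst.comp₂ Primrec₂.right)
    (Primrec.snd.comp₂ Primrec₂.right)
  star := by
    have h : Primrec₂ fun (p : ((ℕ × List ℕ) × List ℕ) × List (List ℕ))
        (x : ℕ × List (List ℕ)) => [] :: concatLists p.2 x.2 :=
      Primrec.list_cons.comp₂ (Primrec₂.const []) (primrec_concatLists.comp₂
        (Primrec.snd.comp₂ Primrec₂.left) (Primrec.snd.comp₂ Primrec₂.right))
    exact Primrec.nat_rec' (Primrec.list_length.comp (Primrec.snd.comp Primrec.fst))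
      (Primrec.const [[]]) h

theorem primrec_exprMem : Primrec₂ fun (x : ℕ × List ℕ) (w : List ℕ) => exprMem x.1 x.2 w :=
  primrec_any (primrecAlgebra_wordsAlgebra.evalString (Primrec.fst.comp Primrec.fst)
    (Primrec.snd.comp Primrec.fst))
    (Primrec.eq.decide.comp₂ Primrec₂.right (Primrec.snd.comp₂ Primrec₂.left))

end WordFO

/-! ### Decidability of first-order definability -/

namespace WordFO

/-- The minimal automaton, computed from an automaton. -/
def minAutOfNFA (x : ℕ × AutomatonData) : AutomatonData :=
  minimalAutomaton x.1 (lengthBound (2 ^ x.2.1)) (nfaMem x.2)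

/-- The minimal automaton, computed from a rational expression. -/
def minAutOfExpr (x : ℕ × List ℕ) : AutomatonData :=
  minimalAutomaton x.1 (lengthBound (boundAlgebra.evalString x.1 x.2)) (exprMem x.1 x.2)

/-- The multiplication table of the syntactic monoid, computed from an automaton. -/
def tableOfNFA (x : ℕ × AutomatonData) : List (List ℕ) :=
  syntacticTable x.1 (lengthBound (2 ^ x.2.1)) (nfaMem x.2)

theorem primrec_nfaBound : Primrec fun x : ℕ × AutomatonData => lengthBound (2 ^ x.2.1) :=
  primrec_lengthBound.comp (primrec_pow.comp (Primrec.const 2) (Primrec.fst.comp Primrec.snd))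

theorem primrec_minAutOfNFA : Primrec minAutOfNFA :=
  primrec_minimalAutomaton (primrec_nfaMem.comp₂ (Primrec.snd.comp₂ Primrec₂.left) Primrec₂.right)
    Primrec.fst primrec_nfaBound

theorem primrec_minAutOfExpr : Primrec minAutOfExpr :=
  primrec_minimalAutomaton primrec_exprMem Primrec.fst (primrec_lengthBound.comp
    (primrecAlgebra_boundAlgebra.evalString Primrec.fst Primrec.snd))

theorem primrec_tableOfNFA : Primrec tableOfNFA :=
  primrec_syntacticTable (primrec_nfaMem.comp₂ (Primrec.snd.comp₂ Primrec₂.left) Primrec₂.right)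
    Primrec.fst primrec_nfaBound

theorem isMinimalAutomaton_minAutOfNFA (n : ℕ) (d : AutomatonData) :
    IsMinimalAutomaton n (minAutOfNFA (n, d)) (d.toNFA n).accepts :=
  isMinimalAutomaton_minimalAutomaton (isMembershipTest_nfaMem n d) (quotientBound_nfa _)

theorem isMinimalAutomaton_minAutOfExpr (n : ℕ) (e : RegularExpression (Fin n)) :
    IsMinimalAutomaton n (minAutOfExpr (n, e.postfixString)) e.matches' := by
  refine isMinimalAutomaton_minimalAutomaton (isMembershipTest_exprMem e) ?_
  rw [ExprAlgebra.evalString_postfixString]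
  exact quotientBound_eval e

theorem isMultiplicationTable_tableOfNFA (n : ℕ) (d : AutomatonData) :
    IsMultiplicationTable (tableOfNFA (n, d)) (SyntacticMonoid (d.toNFA n).accepts) :=
  isMultiplicationTable_syntacticTable (isMembershipTest_nfaMem n d) (quotientBound_nfa _)

theorem foDefinable_accepts_iff (n : ℕ) (d : AutomatonData) :
    FODefinable (d.toNFA n).accepts ↔ aperiodicTest (tableOfNFA (n, d)) = true :=
  (foDefinable_iff_pow_eq (Language.IsRegular.of_finite_range_leftQuotient
    (quotientBound_nfa (d.toNFA n)).1)).trans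
    (aperiodicTest_iff (isMultiplicationTable_tableOfNFA n d)).symm

theorem foDefinable_matches_iff (n : ℕ) (e : RegularExpression (Fin n)) :
    FODefinable e.matches' ↔
      aperiodicTest (tableOfNFA (n, minAutOfExpr (n, e.postfixString))) = true := by
  rw [← foDefinable_accepts_iff,
    accepts_eq_of_isMinimalAutomaton (isMinimalAutomaton_minAutOfExpr n e)]

theorem computablePred_foDefinable_accepts :
    ComputablePred fun x : ℕ × AutomatonData => FODefinable (x.2.toNFA x.1).accepts := by
  rw [ComputablePred.computable_iff]
  refine ⟨fun x => aperiodicTest (tableOfNFA x),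
    (primrec_aperiodicTest.comp primrec_tableOfNFA).to_comp, ?_⟩
  funext x
  exact propext (foDefinable_accepts_iff x.1 x.2)

theorem computablePred_foDefinable_matches :
    ComputablePred fun x : ℕ × List ℕ =>
      ∃ e : RegularExpression (Fin x.1), x.2 = e.postfixString ∧ FODefinable e.matches' := by
  rw [ComputablePred.computable_iff]
  refine ⟨fun x => decide (postfixAlgebra.run x.1 x.2 = [x.2]) &&
    aperiodicTest (tableOfNFA (x.1, minAutOfExpr x)), ?_, ?_⟩
  · refine (Primrec.and.comp ?_ (primrec_aperiodicTest.comp (primrec_tableOfNFA.comp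
      (Primrec.pair Primrec.fst primrec_minAutOfExpr)))).to_comp
    exact Primrec.eq.decide.comp
      (primrecAlgebra_postfixAlgebra.run Primrec.fst Primrec.snd)
      (Primrec.list_cons.comp Primrec.snd (Primrec.const []))
  · funext ⟨n, s⟩
    simp only [Bool.and_eq_true, decide_eq_true_eq, ← exists_postfixString_eq_iff]
    refine propext ⟨?_, ?_⟩
    · rintro ⟨e, rfl, h⟩
      exact ⟨⟨e, rfl⟩, (foDefinable_matches_iff n e).1 h⟩
    · rintro ⟨⟨e, rfl⟩, h⟩
      exact ⟨e, rfl, (foDefinable_matches_iff n e).2 h⟩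

end WordFO

theorem mainTheorem3 :
    -- decidability, for languages given by an automaton
    ComputablePred (fun x : ℕ × AutomatonData => FODefinable (x.2.toNFA x.1).accepts) ∧
    -- decidability, for languages given by a rational expression
    ComputablePred (fun x : ℕ × List ℕ =>
      ∃ e : RegularExpression (Fin x.1), x.2 = e.postfixString ∧ FODefinable e.matches') ∧
    -- the decision procedure
    (∃ (minAut : ℕ × AutomatonData → AutomatonData) (minExp : ℕ × List ℕ → AutomatonData)
        (table : ℕ × AutomatonData → List (List ℕ)) (test : List (List ℕ) → Bool),
      Computable minAut ∧ Computable minExp ∧ Computable table ∧ Computable test ∧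
      (∀ (n : ℕ) (d : AutomatonData),
        IsMinimalAutomaton n (minAut (n, d)) (d.toNFA n).accepts) ∧
      (∀ (n : ℕ) (e : RegularExpression (Fin n)),
        IsMinimalAutomaton n (minExp (n, e.postfixString)) e.matches') ∧
      (∀ (n : ℕ) (d : AutomatonData) (L : Language (Fin n)),
        IsMinimalAutomaton n d L → IsMultiplicationTable (table (n, d)) (SyntacticMonoid L)) ∧
      (∀ (M : Type) [Monoid M] (t : List (List ℕ)), IsMultiplicationTable t M →
        (test t = true ↔ ∀ m : M, m ^ (Nat.card M - 1) = m ^ Nat.card M))) ∧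
    -- correctness of the test
    (∀ (n : ℕ) (L : Language (Fin n)), L.IsRegular →
      Finite (SyntacticMonoid L) ∧
      (FODefinable L ↔ ∀ m : SyntacticMonoid L,
        m ^ (Nat.card (SyntacticMonoid L) - 1) = m ^ Nat.card (SyntacticMonoid L))) ∧
    -- the successor relation adds no expressive power in the presence of the order
    (∀ (n : ℕ) (L : Language (Fin n)), FODefinable L ↔ FOLtDefinable L) := by
  refine ⟨WordFO.computablePred_foDefinable_accepts, WordFO.computablePred_foDefinable_matches,
    ⟨WordFO.minAutOfNFA, WordFO.minAutOfExpr, WordFO.tableOfNFA, WordFO.aperiodicTest,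
      WordFO.primrec_minAutOfNFA.to_comp, WordFO.primrec_minAutOfExpr.to_comp,
      WordFO.primrec_tableOfNFA.to_comp, WordFO.primrec_aperiodicTest.to_comp,
      WordFO.isMinimalAutomaton_minAutOfNFA, WordFO.isMinimalAutomaton_minAutOfExpr,
      fun n d L h => ?_, fun M _ t ht => WordFO.aperiodicTest_iff ht⟩,
    fun n L hL => ⟨WordFO.finite_syntacticMonoid hL, WordFO.foDefinable_iff_pow_eq hL⟩,
    fun n L => WordFO.foDefinable_iff_foLtDefinable L⟩
  rw [← WordFO.accepts_eq_of_isMinimalAutomaton h]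
  exact WordFO.isMultiplicationTable_tableOfNFA n d
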